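/- For $q\in(1,2]$ and $d=(d_i)_{i\ge1}\in\{0,1\}^{\mathbb N}$ put $(d)_q=\sum_{i\ge1}d_iq^{-i}$; $d$ is an expansion of $x$ in base $q$ if $(d)_q=x$. For $x>0$ let $\mathscr U(x)$ be the set of bases $q\in(1,2]$ in which $x$ has exactly one expansion, let $q_s(x)=\inf\mathscr U(x)$, and let $\overline{\mathscr U}$ be the closure of $\mathscr U=\mathscr U(1)$. Let $q_G=(1+\sqrt5)/2$, let $\alpha(q)=\alpha_1(q)\alpha_2(q)\dots$ be the quasi-greedy expansion of $1$ in base $q$ (the lexicographically largest expansion of $1$ not ending in $0^\infty$), and let $\overline{c_1c_2\dots}=(1-c_1)(1-c_2)\dots$ for words and sequences. For $x\in(0,1)$ consider the following algorithm. Let $j\ge0$ be the integer with $q_G^{-(j+1)}\le x<q_G^{-j}$, put $W_1=0^j$, and let $q_1\in(1,2)$ be the root of $q^{j+1}(q-1)=1/x$. In step $k\ge1$, given the word $W_k$ and the base $q_k$: if $q_k\in\overline{\mathscr U}$, stop. Otherwise let $n_k\ge1$ be the smallest $n$ such that $\overline{\alpha_n(q_k)\alpha_{n+1}(q_k)\dots}$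 is lexicographically greater than or equal to $\alpha(q_k)$, put $B_k=1\,\overline{\alpha_1(q_k)\dots\alpha_{n_k-2}(q_k)}$ and $W_{k+1}=W_kB_k$, let $q_{k+1}\in(1,2]$ be the base with $(W_{k+1}01^\infty)_{q_{k+1}}=x$, and go to step $k+1$. Let $X_I$ be the set of $x\in(0,1)$ for which this algorithm stops, after finitely many steps, at a base $q_k\in\overline{\mathscr U}$. (i) Let $x\in(0,1)$. If $q_s(x)\notin\overline{\mathscr U}$, then $q_s(x)=\min\mathscr U(x)$, that is, the infimum is attained. (ii) $X_I$ is a Lebesgue null set. (iii) Consequently, $q_s(x)=\min\mathscr U(x)$ for Lebesgue almost every $x\in(0,1)$. -/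

import Mathlib

noncomputable section

namespace Univoque

/-- Infinite sequences of binary digits (`true` is the digit `1`, `false` is the digit `0`).
The digit written `d_i` on paper, with `i ≥ 1`, is `d (i - 1)` here. -/
abbrev DigitSeq : Type := ℕ → Bool

/-- The value `(d_i)_q = ∑_{i ≥ 1} d_i / q ^ i` of a digit sequence in base `q`. -/
def value (q : ℝ) (d : DigitSeq) : ℝ :=
  ∑' i : ℕ, (if d i then (1 : ℝ) else 0) / q ^ (i + 1)

/-- `𝒰(x)`: the set of all bases `q ∈ (1, 2]` in which `x` has exactly one expansion. -/
def univoqueBases (x : ℝ) : Set ℝ :=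
  {q | q ∈ Set.Ioc (1 : ℝ) 2 ∧ ∃! d : DigitSeq, value q d = x}

/-- `q_s(x) = inf 𝒰(x)`. -/
def smallestBase (x : ℝ) : ℝ := sInf (univoqueBases x)

/-- The closure of `𝒰 = 𝒰(1)`. -/
def closureU : Set ℝ := closure (univoqueBases 1)

/-- `d` is the quasi-greedy expansion of `x` in base `q`: the lexicographically largest one
among the expansions of `x` in base `q` that do not end in `0^∞`. -/
def IsQuasiGreedy (q x : ℝ) (d : DigitSeq) : Prop :=
  IsGreatest {e : Lex DigitSeq |
    value q (ofLex e) = x ∧ ∀ N : ℕ, ∃ i ≥ N, ofLex e i = true} (toLex d)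

/-- The reflection `(1 - d_1)(1 - d_2)…` of a digit sequence. -/
def reflect (d : DigitSeq) : DigitSeq := fun i => !(d i)

/-- The tail `d_n d_{n+1} …` for `n ≥ 1`. -/
def tailFrom (n : ℕ) (d : DigitSeq) : DigitSeq := fun i => d (i + (n - 1))

/-- The sequence that starts with the finite word `w` and continues with `d`. -/
def appendSeq (w : List Bool) (d : DigitSeq) : DigitSeq :=
  fun i => if i < w.length then w.getD i false else d (i - w.length)

/-- The sequence `w 0 1^∞`. -/
def wordZeroOnes (w : List Bool) : DigitSeq :=
  appendSeq (w ++ [false]) (fun _ => true)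

/-- The block `1 (1 - a_1) … (1 - a_{n-2})`. -/
def block (a : DigitSeq) (n : ℕ) : List Bool :=
  true :: (List.range (n - 2)).map (fun i => !(a i))

/-- `AlgorithmReaches x w q`: the algorithm for `q_s(x)`, run on `x ∈ (0, 1)`, arrives after
finitely many steps at the base `q` (called `q_k` in step `k`), and the blocks produced before
form the word `w` (which is `0^j B_1 … B_{k-1}` in step `k`).

* First step: if `q_G ^ (-(j+1)) ≤ x < q_G ^ (-j)`, where `q_G` is the golden ratio, then `w = 0^j`
  and `q` is the root in `(1, 2)` of `q ^ (j+1) * (q - 1) = 1 / x`.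
* Next step: at a base `q` in the closure of `𝒰` the algorithm stops. Otherwise, let `a = α(q)` be
  the quasi-greedy expansion of `1` in base `q`, let `n ≥ 1` be the smallest index for which the
  reflection of `a_n a_{n+1} …` is lexicographically at least `a`, and let
  `B = 1 (1 - a_1) … (1 - a_{n-2})`. The next base `q'` is the one with `(w B 0 1^∞)_{q'} = x`. -/
inductive AlgorithmReaches (x : ℝ) : List Bool → ℝ → Prop
  | start (j : ℕ) (q : ℝ)
      (hlower : Real.goldenRatio⁻¹ ^ (j + 1) ≤ x) (hupper : x < Real.goldenRatio⁻¹ ^ j)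
      (hq : q ∈ Set.Ioo (1 : ℝ) 2) (hroot : q ^ (j + 1) * (q - 1) = 1 / x) :
      AlgorithmReaches x (List.replicate j false) q
  | next (w : List Bool) (q q' : ℝ) (a : DigitSeq) (n : ℕ)
      (hprev : AlgorithmReaches x w q) (hcontinue : q ∉ closureU)
      (ha : IsQuasiGreedy q 1 a)
      (hn : IsLeast {m : ℕ | 1 ≤ m ∧ toLex a ≤ toLex (reflect (tailFrom m a))} n)
      (hq' : q' ∈ Set.Ioc (1 : ℝ) 2)
      (hx : value q' (wordZeroOnes (w ++ block a n)) = x) :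
      AlgorithmReaches x (w ++ block a n) q'

/-- `X_I`: the points of `(0, 1)` for which the algorithm stops, after finitely many steps, at a
base in the closure of `𝒰`. -/
def typeI : Set ℝ :=
  {x | x ∈ Set.Ioo (0 : ℝ) 1 ∧ ∃ w q, AlgorithmReaches x w q ∧ q ∈ closureU}

end Univoque

end

/-! An expansion is unique exactly when no digit can be switched (`Strict`): each tail after a 0,
and each reflected tail after a 1, has value below 1. The closed condition `Weak` survives limits of
bases and sequences.

Suppose that q = q_s(x) is not attained. Unique expansions of x in bases tending to q from above
subconverge to a weak expansion d of x that is not strict, so a tail of d, or its reflection, is a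
weak expansion e of 1. If q lies outside the closure of 𝒰, `mem_closureU_of_weak` forces e = c c̄ c
c̄ …, and `Weak.isolated` shows that such an e is isolated among weak sequences of nearby bases. The
approximating expansions then eventually equal d, which is impossible because (d)_r < (d)_q for r >
q. This is (i).

For the measure statements, the closure of 𝒰 is null (`volume_closureU`): weak expansions of 1 in a
base below 2 have bounded runs. If the algorithm stops, or if the infimum is not attained, then x =
(d)_q with q in this closure and d eventually constant. There are countably many such d, and each
map q ↦ (d)_q is differentiable, so these x form a null set (`exceptional`). Thus (iii) follows from
this set directly, without passing through X_I. -/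

namespace Univoque

open Filter Topology MeasureTheory

/-! ### Values of digit sequences -/

/-- The digit `b` as a real number. -/
noncomputable def digit (b : Bool) : ℝ := if b then 1 else 0

/-- The sequence with its first `n` digits removed. -/
def shift (n : ℕ) (d : DigitSeq) : DigitSeq := fun i => d (i + n)

@[simp] lemma shift_apply (n : ℕ) (d : DigitSeq) (i : ℕ) : shift n d i = d (i + n) := rfl

@[simp] lemma reflect_apply (d : DigitSeq) (i : ℕ) : reflect d i = !d i := rfl

@[simp] lemma reflect_reflect (d : DigitSeq) : reflect (reflect d) = d := by
  funext i; simp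

@[simp] lemma shift_zero (d : DigitSeq) : shift 0 d = d := rfl

lemma shift_shift (m n : ℕ) (d : DigitSeq) : shift m (shift n d) = shift (m + n) d := by
  funext i; simp [add_assoc]

lemma reflect_shift (n : ℕ) (d : DigitSeq) : reflect (shift n d) = shift n (reflect d) := rfl

lemma digit_nonneg (b : Bool) : 0 ≤ digit b := by cases b <;> simp [digit]

lemma digit_le_one (b : Bool) : digit b ≤ 1 := by cases b <;> simp [digit]

@[simp] lemma digit_true : digit true = 1 := by simp [digit]

@[simp] lemma digit_false : digit false = 0 := by simp [digit]

lemma digit_not (b : Bool) : digit (!b) = 1 - digit b := by cases b <;> simp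

lemma value_def (q : ℝ) (d : DigitSeq) : value q d = ∑' i, digit (d i) / q ^ (i + 1) := rfl

lemma hasSum_ones {q : ℝ} (hq : 1 < q) : HasSum (fun i : ℕ => 1 / q ^ (i + 1)) (1 / (q - 1)) := by
  have h := (hasSum_geometric_of_lt_one (r := q⁻¹) (by positivity) (inv_lt_one_of_one_lt₀ hq)).mul_left q⁻¹
  have h0 : q ≠ 0 := by positivity
  have h1 : q - 1 ≠ 0 := by linarith
  have e1 : (fun i : ℕ => 1 / q ^ (i + 1)) = fun i : ℕ => q⁻¹ * q⁻¹ ^ i := by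
    funext i; rw [← pow_succ', inv_pow, one_div]
  have e2 : 1 / (q - 1) = q⁻¹ * (1 - q⁻¹)⁻¹ := by
    rw [← mul_inv, mul_sub, mul_inv_cancel₀ h0, mul_one, one_div]
  rw [e1, e2]; exact h

lemma term_le {q : ℝ} (hq : 1 < q) (d : DigitSeq) (i : ℕ) :
    digit (d i) / q ^ (i + 1) ≤ 1 / q ^ (i + 1) := by
  have : 0 < q := by linarith
  gcongr
  exact digit_le_one _

lemma term_nonneg {q : ℝ} (hq : 1 < q) (d : DigitSeq) (i : ℕ) :
    0 ≤ digit (d i) / q ^ (i + 1) := by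
  have : 0 < q := by linarith
  have := digit_nonneg (d i)
  positivity

lemma summable_terms {q : ℝ} (hq : 1 < q) (d : DigitSeq) :
    Summable fun i : ℕ => digit (d i) / q ^ (i + 1) :=
  Summable.of_nonneg_of_le (term_nonneg hq d) (term_le hq d) (hasSum_ones hq).summable

lemma value_nonneg {q : ℝ} (hq : 1 < q) (d : DigitSeq) : 0 ≤ value q d :=
  tsum_nonneg (term_nonneg hq d)

lemma value_ones {q : ℝ} (hq : 1 < q) : value q (fun _ => true) = 1 / (q - 1) := by
  rw [value_def, ← (hasSum_ones hq).tsum_eq]; simp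

lemma value_zeros (q : ℝ) : value q (fun _ => false) = 0 := by
  rw [value_def]; simp

lemma value_le {q : ℝ} (hq : 1 < q) (d : DigitSeq) : value q d ≤ 1 / (q - 1) := by
  rw [← (hasSum_ones hq).tsum_eq]
  exact (summable_terms hq d).tsum_le_tsum (term_le hq d) (hasSum_ones hq).summable

lemma value_pos {q : ℝ} (hq : 1 < q) {d : DigitSeq} {i : ℕ} (hi : d i = true) : 0 < value q d := by
  have h : 0 < q := by linarith
  refine (summable_terms hq d).tsum_pos (term_nonneg hq d) i ?_
  simp only [hi, digit_true]; positivity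

lemma value_reflect {q : ℝ} (hq : 1 < q) (d : DigitSeq) :
    value q (reflect d) = 1 / (q - 1) - value q d := by
  have h := (hasSum_ones hq).sub (summable_terms hq d).hasSum
  rw [value_def q d, ← h.tsum_eq, value_def]
  congr 1; funext i
  rw [reflect_apply, digit_not]; ring

lemma value_prefix {q : ℝ} (hq : 1 < q) (d : DigitSeq) (n : ℕ) :
    value q d = ∑ i ∈ Finset.range n, digit (d i) / q ^ (i + 1) + value q (shift n d) / q ^ n := by
  have h0 : q ≠ 0 := by positivity
  rw [value_def q d, ← (summable_terms hq d).sum_add_tsum_nat_add n, value_def, ← tsum_div_const]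
  congr 2; funext i
  rw [shift_apply, div_div, ← pow_add]; congr 2; ring

lemma value_step {q : ℝ} (hq : 1 < q) (d : DigitSeq) :
    value q d = (digit (d 0) + value q (shift 1 d)) / q := by
  rw [value_prefix hq d 1]; simp; ring

lemma value_shift_step {q : ℝ} (hq : 1 < q) (d : DigitSeq) (n : ℕ) :
    value q (shift n d) = (digit (d n) + value q (shift (n + 1) d)) / q := by
  rw [value_step hq, shift_shift, shift_apply, zero_add, add_comm 1 n]

lemma value_sub_of_agree {q : ℝ} (hq : 1 < q) {d e : DigitSeq} {n : ℕ} (h : ∀ i < n, d i = e i) :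
    value q d - value q e = (value q (shift n d) - value q (shift n e)) / q ^ n := by
  rw [value_prefix hq d n, value_prefix hq e n,
    Finset.sum_congr rfl (fun i hi => by rw [h i (Finset.mem_range.1 hi)])]
  ring

lemma value_anti {q r : ℝ} (hq : 1 < q) (h : q ≤ r) (d : DigitSeq) : value r d ≤ value q d := by
  refine (summable_terms (hq.trans_le h) d).tsum_le_tsum (fun i => ?_) (summable_terms hq d)
  have := digit_nonneg (d i)
  have : 0 < q := by linarith
  gcongr

lemma value_strictAnti {q r : ℝ} (hq : 1 < q) (h : q < r) {d : DigitSeq} {i : ℕ}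
    (hi : d i = true) : value r d < value q d := by
  refine (summable_terms (hq.trans h) d).tsum_lt_tsum (i := i) (fun i => ?_) ?_ (summable_terms hq d)
  · have := digit_nonneg (d i)
    have : 0 < q := by linarith
    change digit (d i) / r ^ (i + 1) ≤ digit (d i) / q ^ (i + 1)
    gcongr
  · change digit (d i) / r ^ (i + 1) < digit (d i) / q ^ (i + 1)
    rw [hi, digit_true]
    have : 0 < q := by linarith
    gcongr

lemma continuous_digit : Continuous digit := continuous_of_discreteTopology

lemma continuousOn_value : ContinuousOn (fun p : ℝ × DigitSeq => value p.1 p.2)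
    (Set.Ioi 1 ×ˢ Set.univ) := by
  rintro ⟨q, d⟩ ⟨hq, -⟩
  simp only [Set.mem_Ioi] at hq
  obtain ⟨ρ, h1, h2⟩ := exists_between hq
  have : ContinuousOn (fun p : ℝ × DigitSeq => value p.1 p.2) (Set.Ioi ρ ×ˢ Set.univ) := by
    refine continuousOn_tsum (u := fun i => 1 / ρ ^ (i + 1)) (fun i => ?_)
      (hasSum_ones h1).summable ?_
    · refine ContinuousOn.div ?_ ?_ ?_
      · exact ((continuous_digit.comp ((continuous_apply i).comp continuous_snd))).continuousOn
      · fun_prop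
      · rintro ⟨r, e⟩ ⟨hr, -⟩
        simp only [Set.mem_Ioi] at hr
        have : 0 < r := by linarith
        simp only; positivity
    · rintro i ⟨r, e⟩ ⟨hr, -⟩
      simp only [Set.mem_Ioi] at hr
      change ‖digit (e i) / r ^ (i + 1)‖ ≤ _
      rw [Real.norm_of_nonneg (term_nonneg (h1.trans hr) e i)]
      refine (term_le (h1.trans hr) e i).trans ?_
      have : 0 < ρ := by linarith
      gcongr
  exact ((this.continuousAt ((isOpen_Ioi.prod isOpen_univ).mem_nhds (show (q, d) ∈ _ from ⟨h2, trivial⟩)))).continuousWithinAt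

lemma tendsto_value {ι : Type*} {l : Filter ι} {r : ι → ℝ} {q : ℝ} {z : ι → DigitSeq}
    {d : DigitSeq} (hq : 1 < q) (hr : Tendsto r l (𝓝 q)) (hz : Tendsto z l (𝓝 d)) :
    Tendsto (fun k => value (r k) (z k)) l (𝓝 (value q d)) := by
  have h := continuousOn_value.continuousAt (x := (q, d))
    ((isOpen_Ioi.prod isOpen_univ).mem_nhds ⟨hq, trivial⟩)
  exact h.tendsto.comp (hr.prodMk_nhds hz)

lemma continuous_shift (n : ℕ) : Continuous (shift n) :=
  continuous_pi fun i => continuous_apply (i + n)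

lemma continuous_reflect : Continuous reflect :=
  continuous_pi fun i => continuous_of_discreteTopology.comp (continuous_apply i)

lemma eventually_agree {ι : Type*} {l : Filter ι} {z : ι → DigitSeq} {d : DigitSeq}
    (hz : Tendsto z l (𝓝 d)) (n : ℕ) : ∀ᶠ k in l, ∀ i < n, z k i = d i := by
  have : ∀ i ∈ Set.Iio n, ∀ᶠ k in l, z k i = d i := fun i _ =>
    (tendsto_pi_nhds.1 hz i).eventually (IsOpen.mem_nhds (isOpen_discrete {d i}) rfl)
  exact ((Set.finite_Iio n).eventually_all).2 this

/-! ### Existence of expansions and the switching criterion for uniqueness -/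

/-- The orbit of a number under the greedy transformation in base `q`. -/
noncomputable def greedyOrbit (q y : ℝ) : ℕ → ℝ
  | 0 => y
  | n + 1 => if 1 ≤ q * greedyOrbit q y n then q * greedyOrbit q y n - 1 else q * greedyOrbit q y n

/-- Here `q ≤ 2` matters: after a digit 0 the orbit is below 1, hence at most `1 / (q - 1)`. -/
lemma greedyOrbit_mem {q y : ℝ} (hq : 1 < q) (hq2 : q ≤ 2) (h0 : 0 ≤ y) (h1 : y ≤ 1 / (q - 1))
    (n : ℕ) : 0 ≤ greedyOrbit q y n ∧ greedyOrbit q y n ≤ 1 / (q - 1) := by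
  have hp : 0 < q - 1 := by linarith
  rw [le_div_iff₀ hp] at h1
  rw [le_div_iff₀ hp]
  induction n with
  | zero => exact ⟨h0, h1⟩
  | succ n ih =>
    obtain ⟨a, b⟩ := ih
    rw [greedyOrbit]
    split_ifs with h
    · exact ⟨by linarith, by nlinarith⟩
    · exact ⟨by nlinarith, by nlinarith⟩

lemma exists_value_eq {q y : ℝ} (hq : 1 < q) (hq2 : q ≤ 2) (h0 : 0 ≤ y) (h1 : y ≤ 1 / (q - 1)) :
    ∃ d, value q d = y := by
  classical
  have hpos : 0 < q := by linarith
  let d : DigitSeq := fun n => decide (1 ≤ q * greedyOrbit q y n)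
  have key : ∀ n, y = ∑ i ∈ Finset.range n, digit (d i) / q ^ (i + 1) + greedyOrbit q y n / q ^ n := by
    intro n
    induction n with
    | zero => simp [greedyOrbit]
    | succ n ih =>
      rw [Finset.sum_range_succ, add_assoc]
      convert ih using 2
      rw [greedyOrbit]
      by_cases h : 1 ≤ q * greedyOrbit q y n
      · simp only [d, h, decide_true, digit_true, if_true]
        field_simp; ring
      · simp only [d, h, decide_false, digit_false, if_false]
        field_simp; ring
  refine ⟨d, ?_⟩
  have t1 := (summable_terms hq d).hasSum.tendsto_sum_nat
  have t2 : Tendsto (fun n => greedyOrbit q y n / q ^ n) atTop (𝓝 0) := by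
    refine squeeze_zero (g := fun n => 1 / (q - 1) * (q⁻¹) ^ n) (fun n => ?_) (fun n => ?_) ?_
    · have := (greedyOrbit_mem hq hq2 h0 h1 n).1
      positivity
    · rw [inv_pow, ← div_eq_mul_inv]
      have := (greedyOrbit_mem hq hq2 h0 h1 n).2
      gcongr
    · simpa using (tendsto_pow_atTop_nhds_zero_of_lt_one (r := q⁻¹) (by positivity)
        (inv_lt_one_of_one_lt₀ hq)).const_mul (1 / (q - 1))
  have t3 := t1.add t2
  simp only [← key, add_zero] at t3
  exact tendsto_nhds_unique t3 tendsto_const_nhds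

/-- No digit of `d` can be switched in base `q`. -/
def Strict (q : ℝ) (d : DigitSeq) : Prop :=
  ∀ n, (d n = false → value q (shift (n + 1) d) < 1) ∧
    (d n = true → value q (reflect (shift (n + 1) d)) < 1)

/-- The closed version of `Strict`. -/
def Weak (q : ℝ) (d : DigitSeq) : Prop :=
  ∀ n, (d n = false → value q (shift (n + 1) d) ≤ 1) ∧
    (d n = true → value q (reflect (shift (n + 1) d)) ≤ 1)

lemma Strict.weak {q : ℝ} {d : DigitSeq} (h : Strict q d) : Weak q d :=
  fun n => ⟨fun hn => ((h n).1 hn).le, fun hn => ((h n).2 hn).le⟩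

lemma Strict.reflect {q : ℝ} {d : DigitSeq} (h : Strict q d) : Strict q (reflect d) := by
  intro n
  refine ⟨fun hn => ?_, fun hn => ?_⟩
  · exact (h n).2 (by simpa using hn)
  · rw [← reflect_shift, reflect_reflect]
    exact (h n).1 (by simpa using hn)

lemma Weak.reflect {q : ℝ} {d : DigitSeq} (h : Weak q d) : Weak q (reflect d) := by
  intro n
  refine ⟨fun hn => ?_, fun hn => ?_⟩
  · exact (h n).2 (by simpa using hn)
  · rw [← reflect_shift, reflect_reflect]
    exact (h n).1 (by simpa using hn)

lemma Weak.shift {q : ℝ} {d : DigitSeq} (h : Weak q d) (m : ℕ) : Weak q (shift m d) := by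
  intro n
  rw [shift_shift, show n + 1 + m = n + m + 1 by ring]
  exact h (n + m)

lemma exists_first_ne {d e : DigitSeq} (h : d ≠ e) : ∃ j, (∀ i < j, d i = e i) ∧ d j ≠ e j := by
  classical
  have : ∃ j, d j ≠ e j := by
    by_contra! hc
    exact h (funext hc)
  exact ⟨Nat.find this, fun i hi => by simpa using Nat.find_min this hi, Nat.find_spec this⟩

lemma value_eq_of_agree {q : ℝ} (hq : 1 < q) {d e : DigitSeq} {n : ℕ} (h : ∀ i < n, d i = e i)
    (hv : value q d = value q e) : value q (shift n d) = value q (shift n e) := by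
  have h1 := value_sub_of_agree hq h
  rw [hv, sub_self, eq_comm, div_eq_zero_iff] at h1
  rcases h1 with h1 | h1
  · linarith
  · exact absurd h1 (by positivity)

/-- At the first disagreement `e` has the switched digit, and equality of values would push the tail
of `d`, or its reflection, up to at least 1. -/
lemma Strict.unique {q : ℝ} (hq : 1 < q) {d e : DigitSeq} (hd : Strict q d)
    (hv : value q e = value q d) : e = d := by
  by_contra hne
  obtain ⟨j, h1, h2⟩ := exists_first_ne hne
  have h3 := value_eq_of_agree hq h1 hv
  rw [value_shift_step hq e, value_shift_step hq d, div_left_inj' (by positivity)] at h3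
  cases hdj : d j
  · have hej : e j = true := by simpa [hdj] using h2
    have := (hd j).1 hdj
    have := value_nonneg hq (shift (j + 1) e)
    simp [hdj, hej] at h3
    linarith
  · have hej : e j = false := by simpa [hdj] using h2
    have := (hd j).2 hdj
    rw [value_reflect hq] at this
    have := value_le hq (shift (j + 1) e)
    simp [hdj, hej] at h3
    linarith

/-- The sequence `d` with its digits from the `n`-th on replaced by those of `e`. -/
def splice (n : ℕ) (d e : DigitSeq) : DigitSeq := fun i => if i < n then d i else e (i - n)

lemma splice_lt {n i : ℕ} (d e : DigitSeq) (h : i < n) : splice n d e i = d i := by simp [splice, h]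

lemma shift_splice (n : ℕ) (d e : DigitSeq) : shift n (splice n d e) = e := by
  funext i; simp [splice]

lemma splice_shift (n : ℕ) (d : DigitSeq) : splice n d (shift n d) = d := by
  funext i
  by_cases h : i < n
  · simp [splice, h]
  · simp only [splice, h, if_false, shift_apply]; congr 1; omega

lemma strict_of_unique {q : ℝ} (hq : 1 < q) (hq2 : q ≤ 2) {d : DigitSeq}
    (h : ∀ e, value q e = value q d → e = d) : Strict q d := by
  have hp : 0 < q - 1 := by linarith
  have h12 : 1 ≤ 1 / (q - 1) := by rw [le_div_iff₀ hp]; linarith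
  -- a different tail with the same value gives a different expansion
  have key : ∀ n e, value q e = value q (shift n d) → e = shift n d := by
    intro n e he
    have h1 : splice n d e = d := by
      apply h
      have := value_sub_of_agree hq (d := splice n d e) (e := d) (n := n)
        (fun i hi => splice_lt d e hi)
      rw [shift_splice, he, sub_self, zero_div] at this
      linarith
    rw [← congrArg (shift n) h1, shift_splice]
  -- Every admissible remainder `y` has an expansion, so a switched digit with such a remainder
  -- would give a second expansion of the tail.
  have key2 : ∀ n y, 0 ≤ y → y ≤ 1 / (q - 1) → ∀ b, digit b + y = digit (d n) + value q (shift (n + 1) d) →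
      b = d n := by
    intro n y hy0 hy1 b hb
    obtain ⟨e, he⟩ := exists_value_eq hq hq2 hy0 hy1
    have := key n (splice 1 (fun _ => b) e) (by
      rw [value_step hq, shift_splice, value_shift_step hq, splice_lt _ _ one_pos, he, hb])
    have := congrFun this 0
    rwa [splice_lt _ _ one_pos, shift_apply, zero_add] at this
  intro n
  refine ⟨fun hn => ?_, fun hn => ?_⟩
  · by_contra! hc
    have := key2 n (value q (shift (n + 1) d) - 1) (by linarith)
      (by linarith [value_le hq (shift (n + 1) d)]) true (by simp [hn])
    simp [hn] at this
  · by_contra! hc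
    rw [value_reflect hq] at hc
    have := key2 n (value q (shift (n + 1) d) + 1) (by linarith [value_nonneg hq (shift (n + 1) d)])
      (by linarith) false (by simp [hn, add_comm])
    simp [hn] at this

lemma mem_univoqueBases_iff {q x : ℝ} :
    q ∈ univoqueBases x ↔ 1 < q ∧ q ≤ 2 ∧ ∃ d, value q d = x ∧ Strict q d := by
  constructor
  · rintro ⟨⟨h1, h2⟩, d, hd, hu⟩
    exact ⟨h1, h2, d, hd, strict_of_unique h1 h2 fun e he => hu e (he.trans hd)⟩
  · rintro ⟨h1, h2, d, hd, hs⟩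
    exact ⟨⟨h1, h2⟩, d, hd, fun e he => hs.unique h1 (he.trans hd.symm)⟩

lemma exists_switch {d : DigitSeq} (h : ∃ i, d i ≠ d 0) : ∃ n, d n ≠ d (n + 1) := by
  by_contra! hc
  obtain ⟨i, hi⟩ := h
  refine hi ?_
  clear hi
  induction i with
  | zero => rfl
  | succ i ih => exact (hc i).symm.trans ih

/-- The digits 01 force `1 / (q - 1) < q`, so `q` exceeds the golden ratio. The weaker bound 3/2
suffices later: it gives `1 / (q - 1) ≤ 2`, so the reflection of an expansion of 1 has value at most
1. -/
lemma base_gt_of_switch {q : ℝ} (hq : 1 < q) {d : DigitSeq} (hd : Strict q d) {n : ℕ}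
    (h0 : d n = false) (h1 : d (n + 1) = true) : 3 / 2 < q := by
  have a := (hd n).1 h0
  have b := (hd (n + 1)).2 h1
  rw [value_shift_step hq, h1, digit_true, div_lt_one (by linarith)] at a
  rw [value_reflect hq] at b
  have hp : 0 < q - 1 := by linarith
  have c : 1 / (q - 1) < q := by linarith
  rw [div_lt_iff₀ hp] at c
  nlinarith

lemma base_ge {q x : ℝ} (hx0 : 0 < x) (hx1 : x ≤ 1) (h : q ∈ univoqueBases x) : 3 / 2 < q := by
  obtain ⟨hq, hq2, d, hv, hd⟩ := mem_univoqueBases_iff.1 h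
  by_cases hc : ∃ i, d i ≠ d 0
  · obtain ⟨n, hn⟩ := exists_switch hc
    cases h0 : d n
    · exact base_gt_of_switch hq hd h0 (by simpa [h0] using hn)
    · refine base_gt_of_switch hq hd.reflect (n := n) (by simp [h0]) ?_
      simpa [h0] using hn
  · push Not at hc
    have hp : 0 < q - 1 := by linarith
    cases h0 : d 0
    · have : d = fun _ => false := funext fun i => (hc i).trans h0
      rw [this, value_zeros] at hv; linarith
    · have : d = fun _ => true := funext fun i => (hc i).trans h0
      rw [this, value_ones hq] at hv
      rw [← hv, div_le_one hp] at hx1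
      linarith

/-! ### Lexicographic comparison of weak expansions of 1 -/

/-- The strict lexicographic order on digit sequences. -/
def LexLT (a b : DigitSeq) : Prop := ∃ j, (∀ i < j, a i = b i) ∧ a j = false ∧ b j = true

lemma lexLT_or_lexLT {d e : DigitSeq} (h : d ≠ e) : LexLT d e ∨ LexLT e d := by
  obtain ⟨j, h1, h2⟩ := exists_first_ne h
  cases hd : d j
  · exact Or.inl ⟨j, h1, hd, by simpa [hd] using h2⟩
  · exact Or.inr ⟨j, fun i hi => (h1 i hi).symm, by simpa [hd] using h2, hd⟩

lemma LexLT.of_shift {a b : DigitSeq} {n : ℕ} (h : ∀ i < n, a i = b i)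
    (hs : LexLT (shift n a) (shift n b)) : LexLT a b := by
  obtain ⟨j, h1, h2, h3⟩ := hs
  refine ⟨j + n, fun i hi => ?_, h2, h3⟩
  by_cases hin : i < n
  · exact h i hin
  · have := h1 (i - n) (by omega)
    simpa [Nat.sub_add_cancel (not_lt.1 hin)] using this

lemma weak_of_tendsto {ι : Type*} {l : Filter ι} [l.NeBot] {r : ι → ℝ} {q : ℝ} {z : ι → DigitSeq}
    {d : DigitSeq} (hq : 1 < q) (hr : Tendsto r l (𝓝 q)) (hz : Tendsto z l (𝓝 d))
    (hw : ∀ᶠ k in l, Weak (r k) (z k)) : Weak q d := by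
  intro n
  have hn := (eventually_agree hz (n + 1)).mono fun k h => h n (Nat.lt_succ_self n)
  have hs := (continuous_shift (n + 1)).continuousAt.tendsto.comp hz
  refine ⟨fun h => ?_, fun h => ?_⟩
  · refine le_of_tendsto (tendsto_value hq hr hs) ?_
    filter_upwards [hn, hw] with k h1 h2 using (h2 n).1 (h1.trans h)
  · refine le_of_tendsto (tendsto_value hq hr (continuous_reflect.continuousAt.tendsto.comp hs)) ?_
    filter_upwards [hn, hw] with k h1 h2 using (h2 n).2 (h1.trans h)

lemma one_lt_ones {q : ℝ} (hq : 1 < q) (hq2 : q < 2) : 1 < 1 / (q - 1) := by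
  rw [lt_div_iff₀ (by linarith)]; linarith

lemma Weak.value_shift_pos {q : ℝ} (hq : 1 < q) (hq2 : q < 2) {d : DigitSeq} (h : Weak q d) {n : ℕ}
    (hn : d n = true) : 0 < value q (Univoque.shift (n + 1) d) := by
  have := (h n).2 hn
  rw [value_reflect hq] at this
  linarith [one_lt_ones hq hq2]

/-- At the first difference `e` would have 0 followed by a tail of value at most 1, and `z` would
have 1 followed by a tail of positive value (here `q < 2` is needed), so `z` would have value above
1. -/
lemma Weak.not_lexLT {q : ℝ} (hq : 1 < q) (hq2 : q < 2) {z e : DigitSeq} (hz : Weak q z)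
    (hz1 : value q z ≤ 1) (he : Weak q e) (he1 : value q e = 1) : ¬ LexLT e z := by
  rintro ⟨j, h, h0, h1⟩
  have h2 := value_sub_of_agree hq h
  rw [value_shift_step hq e, value_shift_step hq z, h0, h1, digit_true, digit_false, ← sub_div,
    div_div, eq_div_iff (by positivity)] at h2
  have h3 : 0 ≤ (value q e - value q z) * (q * q ^ j) :=
    mul_nonneg (by linarith) (by positivity)
  have h4 := (he j).1 h0
  have h5 := hz.value_shift_pos hq hq2 h1
  linarith

lemma Weak.ext {q : ℝ} (hq : 1 < q) (hq2 : q < 2) {z e : DigitSeq} (hz : Weak q z)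
    (hz1 : value q z = 1) (he : Weak q e) (he1 : value q e = 1) : z = e := by
  by_contra h
  rcases lexLT_or_lexLT h with h | h
  · exact he.not_lexLT hq hq2 he1.le hz hz1 h
  · exact hz.not_lexLT hq hq2 hz1.le he he1 h

lemma Weak.value_shift_le {q : ℝ} (hq : 1 < q) (hq2 : q ≤ 2) {e : DigitSeq} (he : Weak q e)
    (he1 : value q e ≤ 1) (i : ℕ) : value q (Univoque.shift i e) ≤ 1 := by
  induction i with
  | zero => simpa using he1
  | succ i ih =>
    cases h : e i
    · exact (he i).1 h
    · rw [value_shift_step hq, h, digit_true, div_le_one (by linarith)] at ih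
      linarith

lemma value_reflect_le_one {q : ℝ} (hq : 3 / 2 ≤ q) {e : DigitSeq}
    (he1 : value q e = 1) : value q (Univoque.reflect e) ≤ 1 := by
  rw [value_reflect (by linarith), he1]
  have : 1 / (q - 1) ≤ 2 := by rw [div_le_iff₀ (by linarith)]; linarith
  linarith

lemma Weak.value_reflect_shift_le {q : ℝ} (hq : 3 / 2 ≤ q) (hq2 : q ≤ 2) {e : DigitSeq}
    (he : Weak q e) (he1 : value q e = 1) (i : ℕ) :
    value q (Univoque.reflect (Univoque.shift i e)) ≤ 1 := by
  rw [reflect_shift]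
  exact he.reflect.value_shift_le (by linarith) hq2 (value_reflect_le_one hq he1) i

lemma Weak.not_lexLT_shift {q : ℝ} (hq : 3 / 2 ≤ q) (hq2 : q < 2) {e : DigitSeq}
    (he : Weak q e) (he1 : value q e = 1) (i : ℕ) : ¬ LexLT e (Univoque.shift i e) :=
  (he.shift i).not_lexLT (by linarith) hq2 (he.value_shift_le (by linarith) hq2.le he1.le i) he he1

lemma Weak.not_lexLT_reflect_shift {q : ℝ} (hq : 3 / 2 ≤ q) (hq2 : q < 2) {e : DigitSeq}
    (he : Weak q e) (he1 : value q e = 1) (i : ℕ) :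
    ¬ LexLT e (Univoque.reflect (Univoque.shift i e)) :=
  (he.shift i).reflect.not_lexLT (by linarith) hq2
    (he.value_reflect_shift_le hq hq2.le he1 i) he he1

lemma Weak.head {q : ℝ} (hq : 1 < q) {e : DigitSeq} (he : Weak q e) (he1 : value q e = 1) :
    e 0 = true := by
  cases h : e 0
  · have h2 := (he 0).1 h
    rw [value_step hq, h, digit_false, div_eq_iff (by positivity)] at he1
    simp at h2; linarith
  · rfl

/-- If all tails and reflected tails of a family of sequences are lexicographically below an
expansion of `1`, their values are below `1`. -/
lemma value_lt_of_lexLT {q : ℝ} (hq : 1 < q) {f : DigitSeq} (hf : value q f = 1)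
    (hpos : ∀ i, 0 < value q (shift i f)) {z : DigitSeq}
    (hz : ∀ i, LexLT (shift i z) f) : value q z < 1 := by
  have hstep : ∀ z : DigitSeq, LexLT z f → ∃ j, ∃ v > 0,
      value q z - 1 = ((value q (shift (j + 1) z) - 1) - v) / q ^ (j + 1) := by
    rintro z ⟨j, h, h0, h1⟩
    have h2 := value_sub_of_agree hq h
    rw [value_shift_step hq f, value_shift_step hq z, h0, h1, digit_true, digit_false, hf] at h2
    refine ⟨j, _, hpos (j + 1), ?_⟩
    rw [h2, pow_succ]; field_simp; ring
  have hp : 0 < q - 1 := by linarith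
  have hC : 0 < 1 / (q - 1) := by positivity
  -- The excess over 1 of a tail is at most that of a later tail divided by a power of `q`;
  -- iterating shows that no excess is positive.
  have hbound : ∀ n i, value q (shift i z) - 1 ≤ 1 / (q - 1) / q ^ n := by
    intro n
    induction n with
    | zero => intro i; have := value_le hq (shift i z); simp only [pow_zero, div_one]; linarith
    | succ n ih =>
      intro i
      obtain ⟨j, v, hv, h⟩ := hstep _ (hz i)
      rw [h, shift_shift, pow_succ q n, ← div_div]
      have h3 : (value q (shift (j + 1 + i) z) - 1 - v) ≤ 1 / (q - 1) / q ^ n := by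
        linarith [ih (j + 1 + i)]
      have h4 : q ≤ q ^ (j + 1) := le_self_pow₀ hq.le (by omega)
      have h5 : 0 ≤ 1 / (q - 1) / q ^ n := by positivity
      gcongr
  have hle : ∀ i, value q (shift i z) ≤ 1 := by
    intro i
    have t : Tendsto (fun n : ℕ => 1 / (q - 1) / q ^ n) atTop (𝓝 0) :=
      (tendsto_const_nhds).div_atTop (tendsto_pow_atTop_atTop_of_one_lt hq)
    have := ge_of_tendsto' t (fun n => hbound n i)
    linarith
  -- One further step, with `v > 0`, makes the inequality strict.
  obtain ⟨j, v, hv, h⟩ := hstep z (hz 0)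
  have h6 : ((value q (shift (j + 1) z) - 1) - v) / q ^ (j + 1) < 0 :=
    div_neg_of_neg_of_pos (by linarith [hle (j + 1)]) (by positivity)
  linarith

lemma strict_of_lexLT {q : ℝ} (hq : 1 < q) {f : DigitSeq} (hf : value q f = 1)
    (h1 : ∀ i ≥ 1, LexLT (shift i f) f) (h2 : ∀ i, LexLT (reflect (shift i f)) f) :
    Strict q f := by
  have hpos : ∀ i, 0 < value q (shift i f) := by
    intro i
    obtain ⟨j, h, h0, -⟩ := h2 i
    exact value_pos hq (i := j) (by simpa using h0)
  refine fun n => ⟨fun _ => ?_, fun _ => ?_⟩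
  · exact value_lt_of_lexLT hq hf hpos fun i => by
      rw [shift_shift]; exact h1 _ (by omega)
  · exact value_lt_of_lexLT hq hf hpos fun i => by
      rw [← reflect_shift, shift_shift]; exact h2 _

lemma mem_U_of_strict {q : ℝ} (hq : 1 < q) (hq2 : q ≤ 2) {f : DigitSeq} (hf : value q f = 1)
    (h : Strict q f) : q ∈ univoqueBases 1 :=
  mem_univoqueBases_iff.2 ⟨hq, hq2, f, hf, h⟩

lemma closureU_subset : closureU ⊆ Set.Icc (3 / 2) 2 :=
  closure_minimal (fun _ h => ⟨(base_ge one_pos le_rfl h).le, h.1.2⟩) isClosed_Icc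

/-- Weak expansions survive in the limit of bases. -/
lemma exists_limit {x : ℝ} {r : ℕ → ℝ} {q : ℝ} (hq : 1 < q) (hr : Tendsto r atTop (𝓝 q))
    (z : ℕ → DigitSeq) (hv : ∀ k, value (r k) (z k) = x) (hw : ∀ k, Weak (r k) (z k)) :
    ∃ d, ∃ φ : ℕ → ℕ, StrictMono φ ∧ Tendsto (z ∘ φ) atTop (𝓝 d) ∧ value q d = x ∧ Weak q d := by
  obtain ⟨d, -, φ, hφ, hd⟩ := isCompact_univ.tendsto_subseq (x := z) (fun _ => Set.mem_univ _)
  have hr' := hr.comp hφ.tendsto_atTop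
  refine ⟨d, φ, hφ, hd, ?_, weak_of_tendsto hq hr' hd (Eventually.of_forall fun k => hw _)⟩
  refine tendsto_nhds_unique (tendsto_value hq hr' hd) ?_
  simp [hv]

lemma exists_weak_of_mem_closureU {q : ℝ} (h : q ∈ closureU) : ∃ d, value q d = 1 ∧ Weak q d := by
  have hq := closureU_subset h
  obtain ⟨r, hr, hrq⟩ := mem_closure_iff_seq_limit.1 h
  choose h1 h2 z hz using fun k => mem_univoqueBases_iff.1 (hr k)
  obtain ⟨d, -, -, -, hd, hw⟩ := exists_limit (by linarith [hq.1]) hrq z (fun k => (hz k).1)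
    (fun k => (hz k).2.weak)
  exact ⟨d, hd, hw⟩

/-! ### The closure of 𝒰 is a null set -/

/-- The bases in `[ρ, 2]` in which `1` has an expansion with first digit `1` and all runs of length
at most `k`, such that the expansion agrees with `p` on the first `n` digits and has `n`-th
digit `b`. -/
def boundedRuns (k : ℕ) (ρ : ℝ) (p : DigitSeq) (n : ℕ) (b : Bool) : Set ℝ :=
  {q | q ∈ Set.Icc ρ 2 ∧ ∃ d, value q d = 1 ∧ d 0 = true ∧ (∀ i < n, d i = p i) ∧ d n = b ∧
    ∀ i, ∃ j ∈ Finset.Icc 1 k, d (i + j) ≠ d i}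

/-- Because of its first digit 1, `d` loses at least 1/q − 1/r ≥ (r − q)/4 in value when the base
grows to `r`. The common prefix leaves only the tail of `e` after `n` digits to make up for this. -/
lemma base_sub_le {ρ q r : ℝ} (hρ : 1 < ρ) (hq : ρ ≤ q) (hqr : q ≤ r) (hr : r ≤ 2)
    {d e : DigitSeq} {n : ℕ} (h : ∀ i < n, d i = e i) (h0 : d 0 = true) (hd : value q d = 1)
    (he : value r e = 1) : r - q ≤ 4 / (ρ - 1) / ρ ^ n := by
  have hq1 : 1 < q := hρ.trans_le hq
  have hr1 : 1 < r := hq1.trans_le hqr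
  have h1 := value_sub_of_agree hr1 h
  have h2 : value r d - value q d ≤ 1 / r - 1 / q := by
    rw [value_step hq1 d, value_step hr1 d, h0, digit_true, add_div, add_div]
    have : value r (shift 1 d) / r ≤ value q (shift 1 d) / q := by
      have := value_anti hq1 hqr (shift 1 d)
      have := value_nonneg hq1 (shift 1 d)
      gcongr
    linarith
  have h3 : value r (shift n e) / r ^ n ≤ 1 / (ρ - 1) / ρ ^ n := by
    have a := value_le hr1 (shift n e)
    have b : 1 / (r - 1) ≤ 1 / (ρ - 1) := by
      have : 0 < ρ - 1 := by linarith
      gcongr; linarith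
    have : 0 ≤ 1 / (ρ - 1) := by
      have : 0 < ρ - 1 := by linarith
      positivity
    gcongr
    · linarith
    · linarith
  have h4 : 0 ≤ value r (shift n d) / r ^ n := div_nonneg (value_nonneg hr1 _) (by positivity)
  rw [sub_div] at h1
  have h5 : (r - q) / 4 ≤ 1 / q - 1 / r := by
    rw [div_sub_div _ _ (by positivity) (by positivity)]
    have : q * r ≤ 4 := by nlinarith
    have : 0 ≤ r - q := by linarith
    rw [one_mul, mul_one]
    gcongr
  have h6 : 4 / (ρ - 1) / ρ ^ n = 4 * (1 / (ρ - 1) / ρ ^ n) := by ring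
  rw [h6]; rw [hd] at h2
  linarith

lemma boundedRuns_diam {k : ℕ} {ρ : ℝ} (hρ : 1 < ρ) (p : DigitSeq) (n : ℕ) (b : Bool) :
    volume (boundedRuns k ρ p n b) ≤ ENNReal.ofReal (4 / (ρ - 1) / ρ ^ n) := by
  refine (Real.volume_le_diam _).trans (Metric.ediam_le fun q hq r hr => ?_)
  wlog hqr : q ≤ r generalizing q r
  · rw [edist_comm]
    exact this r hr q hq (le_of_not_ge hqr)
  obtain ⟨hq, d, d1, d2, d3, -⟩ := hq
  obtain ⟨hr, e, e1, e2, e3, -⟩ := hr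
  rw [edist_dist, dist_comm, Real.dist_eq, abs_of_nonneg (by linarith)]
  exact ENNReal.ofReal_le_ofReal (base_sub_le hρ hq.1 hqr hr.2
    (fun i hi => (d3 i hi).trans (e3 i hi).symm) d2 d1 e1)

/-- The pieces are indexed by the length `r` of the rest of the run that contains position `n`. -/
lemma boundedRuns_subset (k : ℕ) (ρ : ℝ) (p : DigitSeq) (n : ℕ) (b : Bool) :
    boundedRuns k ρ p n b ⊆
      ⋃ r ∈ Finset.Icc 1 k, boundedRuns k ρ (splice n p fun _ => b) (n + r) (!b) := by
  classical
  rintro q ⟨hq, d, d1, d2, d3, d4, d5⟩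
  have hex : ∃ j, d (n + j) ≠ d n := by
    obtain ⟨j, -, hj⟩ := d5 n
    exact ⟨j, hj⟩
  have hr := Nat.find_spec hex
  have hmin := fun j (hj : j < Nat.find hex) => Nat.find_min hex hj
  set r := Nat.find hex
  obtain ⟨j, hj, hjd⟩ := d5 n
  have hrj : r ≤ j := Nat.find_min' hex hjd
  have hr0 : r ≠ 0 := fun h => hr (by rw [h, add_zero])
  simp only [Set.mem_iUnion]
  refine ⟨r, Finset.mem_Icc.2 ⟨Nat.one_le_iff_ne_zero.2 hr0, hrj.trans (Finset.mem_Icc.1 hj).2⟩,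
    hq, d, d1, d2, fun i hi => ?_, ?_, d5⟩
  · by_cases hin : i < n
    · rw [splice_lt _ _ hin, d3 i hin]
    · have := hmin (i - n) (by omega)
      rw [not_not, Nat.add_sub_cancel' (not_lt.1 hin), d4] at this
      simp [splice, hin, this]
  · rw [d4] at hr
    cases b <;> simpa using hr

lemma volume_boundedRuns_le {k : ℕ} {ρ : ℝ} (hρ : 1 < ρ) (t : ℕ) (p : DigitSeq) (n : ℕ) (b : Bool) :
    volume (boundedRuns k ρ p n b) ≤
      ENNReal.ofReal (4 / (ρ - 1) / ρ ^ n * (∑ r ∈ Finset.Icc 1 k, 1 / ρ ^ r) ^ t) := by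
  have hp : 0 < ρ - 1 := by linarith
  have hp' : 0 < ρ := by linarith
  induction t generalizing p n b with
  | zero => simpa using boundedRuns_diam hρ p n b
  | succ t ih =>
    refine (measure_mono (boundedRuns_subset k ρ p n b)).trans
      ((measure_biUnion_finset_le _ _).trans ((Finset.sum_le_sum fun r _ => ih _ _ _).trans ?_))
    rw [← ENNReal.ofReal_sum_of_nonneg fun r _ => by positivity]
    refine ENNReal.ofReal_le_ofReal (le_of_eq ?_)
    rw [pow_succ, ← mul_assoc, Finset.mul_sum]
    refine Finset.sum_congr rfl fun r _ => ?_
    rw [pow_add]; field_simp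

lemma volume_boundedRuns {k : ℕ} {ρ : ℝ} (hρ : 1 < ρ) (hs : ∑ r ∈ Finset.Icc 1 k, 1 / ρ ^ r < 1)
    (p : DigitSeq) (n : ℕ) (b : Bool) : volume (boundedRuns k ρ p n b) = 0 := by
  have hp' : 0 < ρ := by linarith
  have t := (tendsto_pow_atTop_nhds_zero_of_lt_one
    (Finset.sum_nonneg fun r _ => by positivity) hs).const_mul (4 / (ρ - 1) / ρ ^ n)
  rw [mul_zero] at t
  have t' := ENNReal.tendsto_ofReal t
  rw [ENNReal.ofReal_zero] at t'
  exact le_antisymm (ge_of_tendsto' t' fun m => volume_boundedRuns_le hρ m p n b) zero_le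

/-- A weak expansion of `1` in a base below `2` starts with `1^k 0`, and none of its runs is longer
than `k`. -/
lemma exists_run_bound {q : ℝ} (hq : 3 / 2 ≤ q) (hq2 : q < 2) {d : DigitSeq} (hd : Weak q d)
    (hd1 : value q d = 1) : ∃ k, (∀ i < k, d i = true) ∧ d k = false ∧
      ∀ i, ∃ j ∈ Finset.Icc 1 k, d (i + j) ≠ d i := by
  classical
  have hq1 : 1 < q := by linarith
  have hex : ∃ k, d k = false := by
    by_contra! hc
    have : d = fun _ => true := funext fun i => by simpa using hc i
    rw [this, value_ones hq1] at hd1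
    linarith [one_lt_ones hq1 hq2]
  have hk := Nat.find_spec hex
  have hmin := fun j (hj : j < Nat.find hex) => Nat.find_min hex hj
  set k := Nat.find hex
  have hlt : ∀ i < k, d i = true := fun i hi => by simpa using hmin i hi
  refine ⟨k, hlt, hk, fun i => ?_⟩
  by_contra! hc
  have hc' : ∀ j ≤ k, d (j + i) = d i := by
    intro j hj
    rcases Nat.eq_zero_or_pos j with rfl | h
    · simp
    · rw [add_comm]; exact hc j (Finset.mem_Icc.2 ⟨h, hj⟩)
  cases hdi : d i
  · refine hd.not_lexLT_reflect_shift hq hq2 hd1 i ⟨k, fun j hj => ?_, hk, ?_⟩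
    · simp [hlt j hj, hc' j hj.le, hdi]
    · simp [hc' k le_rfl, hdi]
  · refine hd.not_lexLT_shift hq hq2 hd1 i ⟨k, fun j hj => ?_, hk, ?_⟩
    · simp [hlt j hj, hc' j hj.le, hdi]
    · simp [hc' k le_rfl, hdi]

lemma closureU_subset_iUnion : closureU ⊆ {2} ∪
    ⋃ (k : ℕ) (ρ : ℚ) (_ : 1 < (ρ : ℝ) ∧ ∑ r ∈ Finset.Icc 1 k, 1 / (ρ : ℝ) ^ r < 1),
      boundedRuns k ρ (fun _ => true) 0 true := by
  intro q hq
  have hqI := closureU_subset hq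
  rcases hqI.2.eq_or_lt with h2 | h2
  · exact Or.inl h2
  right
  obtain ⟨d, hd1, hd⟩ := exists_weak_of_mem_closureU hq
  obtain ⟨k, h1, h0, hrun⟩ := exists_run_bound hqI.1 h2 hd hd1
  have hq1 : 1 < q := by linarith [hqI.1]
  -- The expansion starts with 1^k and the remaining tail has positive value. Hence each refinement
  -- by run lengths shrinks the total length of the cover by a factor below 1.
  have hs : ∑ r ∈ Finset.Icc 1 k, 1 / q ^ r < 1 := by
    have a := value_prefix hq1 d k
    rw [hd1, Finset.sum_congr rfl fun i hi => by rw [h1 i (Finset.mem_range.1 hi), digit_true]] at a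
    have b : 0 < value q (shift k d) := by
      obtain ⟨j, -, hj⟩ := hrun k
      refine value_pos hq1 (i := j) ?_
      rw [h0] at hj
      rw [shift_apply, add_comm]; simpa using hj
    have c : 0 < value q (shift k d) / q ^ k := by positivity
    have e : ∑ r ∈ Finset.Icc 1 k, 1 / q ^ r = ∑ i ∈ Finset.range k, 1 / q ^ (i + 1) := by
      rw [← Finset.Ico_add_one_right_eq_Icc, Finset.sum_Ico_eq_sum_range]
      simp [add_comm]
    linarith
  -- The inequality is open in the base, so a rational `ρ < q` can replace `q`; this keeps the union
  -- countable.
  have hev : ∀ᶠ r in 𝓝 q, 1 < r ∧ ∑ i ∈ Finset.Icc 1 k, 1 / r ^ i < 1 := by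
    refine (lt_mem_nhds hq1).and ?_
    have hcont : ContinuousAt (fun r : ℝ => ∑ i ∈ Finset.Icc 1 k, 1 / r ^ i) q := by
      refine tendsto_finsetSum _ fun i _ => ?_
      exact ContinuousAt.div continuousAt_const (by fun_prop) (by positivity)
    exact hcont.eventually_lt continuousAt_const hs
  obtain ⟨ε, hε, hball⟩ := Metric.eventually_nhds_iff.1 hev
  obtain ⟨ρ, hρ1, hρ2⟩ := exists_rat_btwn (show q - ε < q by linarith)
  have := hball (y := ρ) (by rw [Real.dist_eq, abs_lt]; constructor <;> linarith)
  simp only [Set.mem_iUnion]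
  exact ⟨k, ρ, this, ⟨hρ2.le, h2.le⟩, d, hd1, hd.head hq1 hd1, by simp, hd.head hq1 hd1, hrun⟩

lemma volume_closureU : volume closureU = 0 := by
  refine measure_mono_null closureU_subset_iUnion (measure_union_null (by simp) ?_)
  simp only [measure_iUnion_null_iff]
  exact fun k ρ h => volume_boundedRuns h.1 h.2 _ _ _

/-! ### 𝒰(x) is nonempty -/

/-- In base `2`, a number with several expansions has one that ends with `0 1^∞`. -/
lemma exists_dyadic {x : ℝ} (hx : x ∈ Set.Ioo (0 : ℝ) 1) (h : (2 : ℝ) ∉ univoqueBases x) :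
    ∃ (d : DigitSeq) (n : ℕ), value 2 d = x ∧ d n = false ∧ ∀ i > n, d i = true := by
  obtain ⟨d, hd⟩ := exists_value_eq (q := 2) (by norm_num) le_rfl hx.1.le (by norm_num; exact hx.2.le)
  have hns : ¬ Strict 2 d := fun hs => h (mem_univoqueBases_iff.2 ⟨by norm_num, le_rfl, d, hd, hs⟩)
  have ones : ∀ z : DigitSeq, 1 ≤ value 2 z → ∀ i, z i = true := by
    intro z hz i
    by_contra hc
    have := value_pos (q := 2) (by norm_num) (d := reflect z) (i := i) (by simpa using hc)
    rw [value_reflect (by norm_num)] at this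
    norm_num at this; linarith
  simp only [Strict, not_forall] at hns
  obtain ⟨n, hn⟩ := hns
  cases hdn : d n
  · simp only [hdn, true_imp_iff, Bool.false_eq_true, false_imp_iff, and_true, not_lt] at hn
    refine ⟨d, n, hd, hdn, fun i hi => ?_⟩
    have := ones _ hn (i - (n + 1))
    simpa [show i - (n + 1) + (n + 1) = i by omega] using this
  · simp only [hdn, true_imp_iff, Bool.true_eq_false, false_imp_iff, true_and, not_lt] at hn
    have hz := ones _ hn
    have hz2 : shift (n + 1) d = fun _ => false := funext fun i => by simpa using hz i
    -- The ending 1 0^∞ is traded for 0 1^∞.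
    refine ⟨splice n d (splice 1 (fun _ => false) fun _ => true), n, ?_, ?_, fun i hi => ?_⟩
    · have := value_sub_of_agree (q := 2) (by norm_num)
        (d := splice n d (splice 1 (fun _ => false) fun _ => true)) (e := d) (n := n)
        (fun i hi => splice_lt _ _ hi)
      rw [shift_splice, value_step (by norm_num) (splice 1 _ _), shift_splice,
        value_shift_step (by norm_num) d, hz2, hdn, value_zeros, value_ones (by norm_num),
        splice_lt _ _ one_pos] at this
      norm_num at this
      linarith
    · simp [splice]
    · simp [splice, show ¬ i < n by omega, show i - n ≠ 0 by omega]

/-- In bases close to `2`, a sequence with an early digit `0` has value below `1`. -/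
lemma value_lt_one_of_false {q : ℝ} (hq : 1 < q) {z : DigitSeq} {K i : ℕ}
    (hK : (2 - q) * q ^ K < q - 1) (hi : i < K) (hz : z i = false) : value q z < 1 := by
  have hp : 0 < q - 1 := by linarith
  have h1 : 1 / q ^ K ≤ value q (reflect z) := by
    rw [value_def]
    refine le_trans ?_ ((summable_terms hq (reflect z)).le_tsum i fun j _ => term_nonneg hq _ j)
    rw [reflect_apply, hz, Bool.not_false, digit_true]
    have : 0 < q := by linarith
    gcongr
    · exact hq.le
    · omega
  rw [value_reflect hq] at h1
  have h2 : 1 / (q - 1) - 1 < 1 / q ^ K := by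
    rw [div_sub_one hp.ne', div_lt_div_iff₀ hp (by positivity)]
    linarith
  linarith

/-- The sequence that agrees with `d` on the first `M` digits and then alternates. -/
def alternateFrom (M : ℕ) (d : DigitSeq) : DigitSeq := splice M d fun i => decide (i % 2 = 1)

lemma tendsto_alternateFrom (d : DigitSeq) :
    Tendsto (fun M => alternateFrom M d) atTop (𝓝 d) := by
  refine tendsto_pi_nhds.2 fun i => tendsto_const_nhds.congr' ?_
  filter_upwards [eventually_gt_atTop i] with M hM
  exact (splice_lt _ _ hM).symm

lemma alternateFrom_switch {M i : ℕ} (d : DigitSeq) (hi : M ≤ i) :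
    alternateFrom M d (i + 1) = !alternateFrom M d i := by
  simp only [alternateFrom, splice, show ¬ i < M by omega, show ¬ i + 1 < M by omega, if_false]
  rw [show i + 1 - M = i - M + 1 by omega]
  rcases Nat.mod_two_eq_zero_or_one (i - M) with h | h <;> simp [h] <;> omega

/-- Needed because `sInf ∅ = 0`. If base 2 fails, x = (w01^∞)_2; cutting the run of ones far out and
continuing with 0101… gives a sequence that represents x in a base slightly below 2, where it is
strict. -/
lemma univoqueBases_nonempty {x : ℝ} (hx : x ∈ Set.Ioo (0 : ℝ) 1) : (univoqueBases x).Nonempty := by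
  by_cases h : (2 : ℝ) ∈ univoqueBases x
  · exact ⟨2, h⟩
  obtain ⟨d, L, hd, hL, hones⟩ := exists_dyadic hx h
  have hsh : ∀ m > L, value 2 (shift m d) = 1 := fun m hm => by
    have : shift m d = fun _ => true := funext fun i => hones _ (by omega)
    rw [this, value_ones (by norm_num)]; norm_num
  have hev : ∀ᶠ r : ℝ in 𝓝 2, 1 < r ∧ (2 - r) * r ^ (L + 3) < r - 1 := by
    refine (lt_mem_nhds (by norm_num)).and ?_
    have h1 : ContinuousAt (fun r : ℝ => (2 - r) * r ^ (L + 3)) 2 := by fun_prop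
    have h2 : ContinuousAt (fun r : ℝ => r - 1) 2 := by fun_prop
    exact h1.eventually_lt h2 (by norm_num)
  obtain ⟨ε, hε, hball⟩ := Metric.eventually_nhds_iff.1 hev
  have hq0 : ∃ q0 : ℝ, 1 < q0 ∧ q0 < 2 ∧ ∀ r, q0 ≤ r → r ≤ 2 →
      1 < r ∧ (2 - r) * r ^ (L + 3) < r - 1 := by
    refine ⟨2 - min (ε / 2) (1 / 2), ?_, ?_, fun r h1 h2 => hball ?_⟩
    · linarith [min_le_right (ε / 2) (1 / 2)]
    · linarith [lt_min (half_pos hε) (show (0 : ℝ) < 1 / 2 by norm_num)]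
    · rw [Real.dist_eq, abs_lt]
      constructor <;> linarith [min_le_left (ε / 2) (1 / 2)]
  obtain ⟨q0, hq0, hq02, hgood⟩ := hq0
  have hlt : x < value q0 d := by
    rw [← hd]; exact value_strictAnti hq0 hq02 (hones (L + 1) (by omega))
  have hMev := (tendsto_value hq0 tendsto_const_nhds (tendsto_alternateFrom d)).eventually
    (lt_mem_nhds hlt)
  obtain ⟨M, hM, hML⟩ := (hMev.and (eventually_ge_atTop (L + 2))).exists
  set f := alternateFrom M d with hf
  have hfd : ∀ i < M, f i = d i := fun i hi => splice_lt _ _ hi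
  have hfM : f M = false := by simp [hf, alternateFrom, splice]
  have hf2 : value 2 f ≤ x := by
    have h1 := value_sub_of_agree (q := 2) (by norm_num) hfd
    have h2 := hsh M (by omega)
    have h3 := value_le (q := 2) (by norm_num) (shift M f)
    have h4 : (value 2 (shift M f) - value 2 (shift M d)) / 2 ^ M ≤ 0 :=
      div_nonpos_of_nonpos_of_nonneg (by rw [h2]; norm_num at h3; linarith) (by positivity)
    linarith
  have hcont : ContinuousOn (fun q => value q f) (Set.Icc q0 2) := by
    intro q hq
    have : ContinuousAt (fun q => value q f) q :=
      tendsto_value (hq0.trans_le hq.1) tendsto_id tendsto_const_nhds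
    exact this.continuousWithinAt
  obtain ⟨q, hq, hqx⟩ := intermediate_value_Icc' hq02.le hcont ⟨hf2, hM.le⟩
  simp only at hqx
  obtain ⟨hq1, hqK⟩ := hgood q hq.1 hq.2
  have hqne : q ≠ 2 := by
    rintro rfl
    have h1 := value_eq_of_agree hq1 hfd (hqx.trans hd.symm)
    have h3 := value_pos hq1 (d := reflect (shift M f)) (i := 0) (by simp [hfM])
    rw [value_reflect hq1, h1, hsh M (by omega)] at h3
    norm_num at h3
  have hq2 : q < 2 := lt_of_le_of_ne hq.2 hqne
  refine ⟨q, mem_univoqueBases_iff.2 ⟨hq1, hq.2, f, hqx, ?_⟩⟩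
  have hfL : f L = false := (hfd L (by omega)).trans hL
  have hsw : ∀ i ≥ M, f (i + 1) = !f i := fun i hi => alternateFrom_switch d hi
  have hfones : ∀ i, L < i → i < M → f i = true := fun i h1 h2 => (hfd i h2).trans (hones i h1)
  -- The prefix weighs at least as much in base `q` as in base 2, so the tail contributes at most
  -- 1/2^(L+1) < 1/q^(L+1).
  have hcrit : value q (shift (L + 1) f) < 1 := by
    have h1 := value_prefix hq1 f (L + 1)
    have h2 := value_prefix (q := 2) (by norm_num) d (L + 1)
    rw [hsh _ (by omega)] at h2
    have h3 : ∑ i ∈ Finset.range (L + 1), digit (d i) / 2 ^ (i + 1) ≤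
        ∑ i ∈ Finset.range (L + 1), digit (f i) / q ^ (i + 1) := by
      refine Finset.sum_le_sum fun i hi => ?_
      rw [hfd i (by have := Finset.mem_range.1 hi; omega)]
      have := digit_nonneg (d i)
      have : 0 < q := by linarith
      gcongr
    have h4 : value q (shift (L + 1) f) / q ^ (L + 1) ≤ 1 / 2 ^ (L + 1) := by linarith
    have h5 : (1 : ℝ) / 2 ^ (L + 1) < 1 / q ^ (L + 1) := by
      gcongr
    have h6 := h4.trans_lt h5
    rwa [div_lt_div_iff_of_pos_right (by positivity)] at h6
  -- At all other positions the relevant tail or reflected tail has a 0 among its first `L + 3`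
  -- digits, which is enough so close to base 2.
  have hsmall : ∀ (z : DigitSeq) (i : ℕ), i < L + 3 → z i = false → value q z < 1 :=
    fun z i hi hz => value_lt_one_of_false hq1 hqK hi hz
  refine fun n => ⟨fun hn => ?_, fun hn => ?_⟩
  · rcases lt_trichotomy n L with h1 | rfl | h1
    · refine hsmall _ (L - (n + 1)) (by omega) ?_
      rwa [shift_apply, Nat.sub_add_cancel h1]
    · exact hcrit
    · have h2 : M ≤ n := by
        by_contra! hc
        rw [hfones n h1 hc] at hn
        exact absurd hn (by simp)
      refine hsmall _ 1 (by omega) ?_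
      rw [shift_apply, show 1 + (n + 1) = n + 1 + 1 by ring, hsw _ (by omega), hsw _ h2, hn]
      rfl
  · have hsmall' : ∀ i ≤ L + 2, f (i + (n + 1)) = true →
        value q (reflect (shift (n + 1) f)) < 1 :=
      fun i hi h => hsmall _ i (by omega) (by simp [h])
    rcases le_or_gt n L with h1 | h1
    · refine hsmall' (L + 1 - (n + 1)) (by omega) ?_
      rw [Nat.sub_add_cancel (by omega)]
      exact hfones _ (by omega) (by omega)
    · rcases lt_trichotomy (n + 1) M with h2 | h2 | h2
      · exact hsmall' 0 (by omega) (hfones _ (by omega) (by omega))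
      · refine hsmall' 1 (by omega) ?_
        rw [h2, add_comm, hsw _ le_rfl, hfM]
        rfl
      · refine hsmall' 1 (by omega) ?_
        rw [show 1 + (n + 1) = n + 1 + 1 by ring, hsw _ (by omega), hsw _ (by omega), hn]
        rfl

/-! ### Approximation of a base by elements of 𝒰 -/

/-- For the prefix `t` of length `m` of `e`, the sequence `t u u u …`, where `u` is the
reflection of `t` with its last digit changed to `1`. -/
def mirror (e : DigitSeq) (m : ℕ) : DigitSeq :=
  splice m e fun j => if j % m = m - 1 then true else !e (j % m)

/-- No suffix of the prefix of length `m` of `e` is the reflection of a prefix of `e`: the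
reflected suffixes are lexicographically smaller than the corresponding prefixes. -/
def NoReflectedBorder (e : DigitSeq) (m : ℕ) : Prop :=
  ∀ i < m, ∃ j, j + i < m ∧ (∀ l < j, (!e (l + i)) = e l) ∧ e (j + i) = true ∧ e j = true

lemma mirror_lt {e : DigitSeq} {m i : ℕ} (h : i < m) : mirror e m i = e i := splice_lt _ _ h

lemma mirror_add (e : DigitSeq) (m j : ℕ) :
    mirror e m (j + m) = if j % m = m - 1 then true else !e (j % m) := by
  simp [mirror, splice]

lemma mirror_add_lt {e : DigitSeq} {m j : ℕ} (h : j < m - 1) : mirror e m (j + m) = !e j := by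
  rw [mirror_add, Nat.mod_eq_of_lt (by omega), if_neg (by omega)]

lemma mirror_add_last {e : DigitSeq} {m : ℕ} (h : 0 < m) : mirror e m (m - 1 + m) = true := by
  rw [mirror_add, Nat.mod_eq_of_lt (by omega), if_pos rfl]

lemma shift_mirror {e : DigitSeq} {m i : ℕ} (h : m ≤ i) :
    shift i (mirror e m) = shift ((i - m) % m + m) (mirror e m) := by
  funext j
  rw [shift_apply, shift_apply, ← add_assoc, mirror_add, show j + i = j + (i - m) + m by omega,
    mirror_add]
  simp

lemma lexLT_of_max {e : DigitSeq} (hmax : ∀ i, ¬ LexLT e (shift i e)) {i j : ℕ}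
    (h : ∀ l < j, e (l + i) = e l) (hne : e (j + i) ≠ e j) : e (j + i) = false ∧ e j = true := by
  cases hj : e j
  · refine absurd ⟨j, fun l hl => (h l hl).symm, hj, ?_⟩ (hmax i)
    simpa [hj] using hne
  · simpa [hj] using hne

lemma mirror_lexLT_aux {e : DigitSeq} {m l : ℕ} (hG : NoReflectedBorder e m) (hl : 1 ≤ l)
    (hlm : l < m) : LexLT (shift m (mirror e m)) (shift l (mirror e m)) := by
  obtain ⟨j, h1, h2, h3, h4⟩ := hG l hlm
  refine ⟨j, fun k hk => ?_, ?_, ?_⟩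
  · rw [shift_apply, shift_apply, mirror_add_lt (by omega), mirror_lt (by omega), ← h2 k hk,
      Bool.not_not]
  · rw [shift_apply, mirror_add_lt (by omega), h4]; rfl
  · rw [shift_apply, mirror_lt h1, h3]

lemma exists_first {P : ℕ → Prop} (h : ∃ j, ¬ P j) : ∃ j, (∀ l < j, P l) ∧ ¬ P j := by
  classical
  exact ⟨Nat.find h, fun l hl => not_not.1 (Nat.find_min h hl), Nat.find_spec h⟩

/-- A tail that starts inside `t` and copies `e` up to the end of `t` is decided afterwards: there
`u` meets a suffix of `t`, which is larger because it is not a reflected prefix. -/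
lemma mirror_lexLT {e : DigitSeq} {m : ℕ} (hm : 2 ≤ m) (h0 : e 0 = true)
    (hmax : ∀ i, ¬ LexLT e (shift i e)) (hG : NoReflectedBorder e m) {i : ℕ} (hi : 1 ≤ i) :
    LexLT (shift i (mirror e m)) (mirror e m) := by
  rcases lt_or_ge i m with him | him
  · by_cases h : ∀ j, j + i < m → e (j + i) = e j
    · refine LexLT.of_shift (n := m - i) (fun j hj => ?_) ?_
      · rw [shift_apply, mirror_lt (by omega), mirror_lt (by omega), h j (by omega)]
      · rw [shift_shift, Nat.sub_add_cancel him.le]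
        exact mirror_lexLT_aux hG (by omega) (by omega)
    · obtain ⟨j, h1, h2⟩ := exists_first (not_forall.1 h)
      push Not at h2
      obtain ⟨h2, h3⟩ := h2
      have h4 := lexLT_of_max hmax (fun l hl => h1 l hl (by omega)) h3
      refine ⟨j, fun l hl => ?_, ?_, ?_⟩
      · rw [shift_apply, mirror_lt (by omega), mirror_lt (by omega), h1 l hl (by omega)]
      · rw [shift_apply, mirror_lt h2, h4.1]
      · rw [mirror_lt (by omega), h4.2]
  · rw [shift_mirror him]
    have hlm : (i - m) % m < m := Nat.mod_lt _ (by omega)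
    set l := (i - m) % m
    rcases Nat.eq_zero_or_pos l with hl | hl
    · refine ⟨0, by simp, ?_, ?_⟩
      · rw [hl, shift_apply, zero_add, mirror_add_lt (by omega), h0]; rfl
      · rw [mirror_lt (by omega), h0]
    · obtain ⟨j, h1, h2, h3, h4⟩ := hG l hlm
      have hag : ∀ k < j, shift (l + m) (mirror e m) k = mirror e m k := fun k hk => by
        rw [shift_apply, ← add_assoc, mirror_add_lt (by omega), mirror_lt (by omega), h2 k hk]
      rcases Nat.lt_or_ge (j + l) (m - 1) with hj | hj
      · refine ⟨j, hag, ?_, ?_⟩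
        · rw [shift_apply, ← add_assoc, mirror_add_lt hj, h3]; rfl
        · rw [mirror_lt (by omega), h4]
      -- The deciding digit is the one of `u` that was raised to 1, so there is a tie; the next copy
      -- of `u` is then compared with a suffix of `t`.
      · refine LexLT.of_shift (n := m - l) (fun k hk => ?_) ?_
        · rcases Nat.lt_or_ge k j with hkj | hkj
          · exact hag k hkj
          · have hk' : k = j := by omega
            rw [hk', shift_apply, ← add_assoc, show j + l = m - 1 by omega,
              mirror_add_last (by omega), mirror_lt (by omega), h4]
        · rw [shift_shift, show m - l + (l + m) = m + m by omega, shift_mirror (by omega)]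
          simp only [add_tsub_cancel_right, Nat.mod_self, zero_add]
          exact mirror_lexLT_aux hG (by omega) (by omega)

lemma reflect_mirror_lexLT {e : DigitSeq} {m : ℕ} (hm : 2 ≤ m)
    (hmax : ∀ i, ¬ LexLT e (shift i e)) (hG : NoReflectedBorder e m) (i : ℕ) :
    LexLT (reflect (shift i (mirror e m))) (mirror e m) := by
  rcases lt_or_ge i m with him | him
  · obtain ⟨j, h1, h2, h3, h4⟩ := hG i him
    refine ⟨j, fun k hk => ?_, ?_, ?_⟩
    · rw [reflect_apply, shift_apply, mirror_lt (by omega), mirror_lt (by omega), h2 k hk]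
    · rw [reflect_apply, shift_apply, mirror_lt h1, h3]; rfl
    · rw [mirror_lt (by omega), h4]
  · rw [shift_mirror him]
    have hlm : (i - m) % m < m := Nat.mod_lt _ (by omega)
    set l := (i - m) % m
    -- The suffix of length one shows that `t` ends in 1, so raising the last digit of its
    -- reflection is a genuine change. The reflected tails drop below `e` there at the latest.
    obtain ⟨j, h1, -, h3, -⟩ := hG (m - 1) (by omega)
    have hlast : e (m - 1) = true := by
      rwa [show j + (m - 1) = m - 1 by omega] at h3
    have hval : ∀ k, k + l < m - 1 → reflect (shift (l + m) (mirror e m)) k = e (k + l) := by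
      intro k hk
      rw [reflect_apply, shift_apply, ← add_assoc, mirror_add_lt hk, Bool.not_not]
    by_cases h : ∀ k, k + l < m - 1 → e (k + l) = e k
    · refine ⟨m - 1 - l, fun k hk => ?_, ?_, ?_⟩
      · rw [hval k (by omega), mirror_lt (by omega), h k (by omega)]
      · rw [reflect_apply, shift_apply, ← add_assoc, show m - 1 - l + l = m - 1 by omega,
          mirror_add_last (by omega)]
        rfl
      · rw [mirror_lt (by omega)]
        by_contra hc
        have hl : m - 1 - l + l = m - 1 := by omega
        have := lexLT_of_max hmax (i := l) (j := m - 1 - l) (fun k hk => h k (by omega))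
          (by rw [hl, hlast]; exact fun h => hc h.symm)
        exact hc this.2
    · obtain ⟨k, h1, h2⟩ := exists_first (not_forall.1 h)
      push Not at h2
      obtain ⟨h2, h3⟩ := h2
      have h4 := lexLT_of_max hmax (fun l hl => h1 l hl (by omega)) h3
      refine ⟨k, fun n hn => ?_, ?_, ?_⟩
      · rw [hval n (by omega), mirror_lt (by omega), h1 n hn (by omega)]
      · rw [hval k h2, h4.1]
      · rw [mirror_lt (by omega), h4.2]

/-- From a long prefix, remove the longest suffix that is a reflected prefix of `e`; periodicity
bounds its length by `K`. What remains has no reflected border. -/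
lemma exists_noReflectedBorder {e : DigitSeq} {p : ℕ} (hp : 1 ≤ p) (hper : shift p e = e)
    (hmax : ∀ i, ¬ LexLT e (shift i e)) (hrefl : ∀ i, LexLT (reflect (shift i e)) e) (N : ℕ) :
    ∃ m ≥ N, NoReflectedBorder e m := by
  classical
  choose w hw1 hw2 hw3 using hrefl
  have hmod : ∀ i, shift i e = shift (i % p) e := by
    intro i
    induction i using Nat.strong_induction_on with
    | _ i ih =>
      rcases lt_or_ge i p with h | h
      · rw [Nat.mod_eq_of_lt h]
      · rw [Nat.mod_eq_sub_mod h, ← ih (i - p) (by omega), ← congrArg (shift (i - p)) hper,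
          shift_shift, Nat.sub_add_cancel h]
  -- a uniform bound for the first differences
  obtain ⟨K, hK⟩ : ∃ K, ∀ i, ∃ j < K, (!e (j + i)) ≠ e j := by
    refine ⟨(Finset.range p).sup w + 1, fun i => ⟨w (i % p), ?_, ?_⟩⟩
    · exact Nat.lt_succ_of_le (Finset.le_sup (Finset.mem_range.2 (Nat.mod_lt _ hp)))
    · have h2 := hw2 (i % p)
      rw [← hmod i] at h2
      simp only [reflect_apply, shift_apply] at h2
      rw [h2, hw3 (i % p)]; simp
  set M := N + K
  let B : ℕ → Prop := fun l => ∀ j < l, (!e (j + (M - l))) = e j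
  have hB0 : B 0 := by intro j hj; omega
  have hBl : B (Nat.findGreatest B M) := Nat.findGreatest_spec (Nat.zero_le M) hB0
  have hBmax : ∀ l ≤ M, Nat.findGreatest B M < l → ¬ B l :=
    fun l hl h => Nat.findGreatest_is_greatest h hl
  have hlM : Nat.findGreatest B M ≤ M := Nat.findGreatest_le M
  set L := Nat.findGreatest B M
  have hLK : L < K := by
    by_contra! hc
    obtain ⟨j, hj, hne⟩ := hK (M - L)
    exact hne (hBl j (by omega))
  refine ⟨M - L, by omega, fun i hi => ?_⟩
  have a1 : ∀ k < w i, (!e (k + i)) = e k := hw1 i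
  have a2 : e (w i + i) = true := by simpa using hw2 i
  have a3 := hw3 i
  set j := w i
  refine ⟨j, ?_, a1, a2, a3⟩
  by_contra! hc
  rcases le_or_gt M (j + i) with hM | hM
  · refine hBmax (M - i) (by omega) (by omega) fun k hk => ?_
    rw [show M - (M - i) = i by omega]
    exact a1 k (by omega)
  -- Two reflections cancel on the removed suffix, so a tail of `e` would be larger than `e`.
  · refine hmax (M - L - i) ⟨j + i - (M - L), fun k hk => ?_, ?_, ?_⟩
    · rw [shift_apply, ← a1 (k + (M - L - i)) (by omega), ← hBl k (by omega)]
      congr 2; omega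
    · rw [← hBl _ (by omega), show j + i - (M - L) + (M - L) = j + i by omega, a2]; rfl
    · rw [shift_apply, show j + i - (M - L) + (M - L - i) = j by omega, a3]

/-- If arbitrarily long prefixes of the expansion `e` of `1` have no reflected border, then the
bases in which the sequences `mirror e m` expand `1` are in `𝒰` and approximate the base of `e`. -/
lemma mem_closureU_of_mirror {q : ℝ} (hq : 1 < q) (hq2 : q < 2) {e : DigitSeq} (h0 : e 0 = true)
    (he : value q e = 1) (hmax : ∀ i, ¬ LexLT e (shift i e))
    (hG : ∀ N, ∃ m ≥ N, NoReflectedBorder e m) : q ∈ closureU := by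
  refine Metric.mem_closure_iff.2 fun ε hε => ?_
  obtain ⟨a, ha1, ha2⟩ : ∃ a, max 1 (q - ε) < a ∧ a < q := exists_between (by simp [hq, hε])
  obtain ⟨b, hb1, hb2⟩ : ∃ b, q < b ∧ b < min 2 (q + ε) := exists_between (by simp [hq2, hε])
  rw [max_lt_iff] at ha1
  rw [lt_min_iff] at hb2
  have tm : Tendsto (mirror e) atTop (𝓝 e) := by
    refine tendsto_pi_nhds.2 fun i => tendsto_const_nhds.congr' ?_
    filter_upwards [eventually_gt_atTop i] with M hM
    exact (mirror_lt hM).symm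
  have e1 := (tendsto_value ha1.1 tendsto_const_nhds tm).eventually
    (lt_mem_nhds (he ▸ value_strictAnti ha1.1 ha2 h0 : 1 < value a e))
  have e2 := (tendsto_value (hq.trans hb1) tendsto_const_nhds tm).eventually
    (gt_mem_nhds (he ▸ value_strictAnti hq hb1 h0 : value b e < 1))
  obtain ⟨N, hN⟩ := eventually_atTop.1 (e1.and e2)
  obtain ⟨m, hm, hGm⟩ := hG (N + 2)
  obtain ⟨h1, h2⟩ := hN m (by omega)
  have hcont : ContinuousOn (fun r => value r (mirror e m)) (Set.Icc a b) := by
    intro r hr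
    have : ContinuousAt (fun r => value r (mirror e m)) r :=
      tendsto_value (ha1.1.trans_le hr.1) tendsto_id tendsto_const_nhds
    exact this.continuousWithinAt
  obtain ⟨r, hr, hr1⟩ := intermediate_value_Icc' (ha2.trans hb1).le hcont ⟨h2.le, h1.le⟩
  have hr' : 1 < r := ha1.1.trans_le hr.1
  refine ⟨r, mem_U_of_strict hr' (hr.2.trans hb2.1.le) hr1 (strict_of_lexLT hr' hr1
    (fun i hi => mirror_lexLT (by omega) h0 hmax hGm hi)
    (reflect_mirror_lexLT (by omega) hmax hGm)), ?_⟩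
  rw [dist_comm, Real.dist_eq, abs_lt]
  constructor <;> linarith [hr.1, hr.2]

/-- Weakness makes `e` at least as large as its tails and their reflections. If `e` is not periodic,
all comparisons are strict and `q` lies in 𝒰; if it is periodic, the mirrored prefixes approximate
it. -/
lemma mem_closureU_of_weak {q : ℝ} (hq : 3 / 2 ≤ q) (hq2 : q < 2) {e : DigitSeq} (hw : Weak q e)
    (he : value q e = 1) (hne : ∀ i, reflect (shift i e) ≠ e) : q ∈ closureU := by
  have hq1 : 1 < q := by linarith
  have hmax := hw.not_lexLT_shift hq hq2 he
  have hrefl : ∀ i, LexLT (reflect (shift i e)) e := fun i =>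
    (lexLT_or_lexLT (hne i)).resolve_right (hw.not_lexLT_reflect_shift hq hq2 he i)
  by_cases hper : ∃ p ≥ 1, shift p e = e
  · obtain ⟨p, hp, hpe⟩ := hper
    exact mem_closureU_of_mirror hq1 hq2 (hw.head hq1 he) he hmax
      (exists_noReflectedBorder hp hpe hmax hrefl)
  · push Not at hper
    exact subset_closure (mem_U_of_strict hq1 hq2.le he (strict_of_lexLT hq1 he
      (fun i hi => (lexLT_or_lexLT (hper i hi)).resolve_right (hmax i)) hrefl))

/-! ### Isolated expansions of 1 -/

/-- By compactness, failure would produce in the limit a second weak expansion of 1 in base `q`,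
against `Weak.ext`. -/
lemma Weak.exists_agree {q : ℝ} (hq : 1 < q) (hq2 : q < 2) {e : DigitSeq} (he : Weak q e)
    (he1 : value q e = 1) (m : ℕ) : ∃ ε > 0, ∀ r, |r - q| < ε → ∀ z, Weak r z → value r z ≤ 1 →
      1 - ε < value r z → ∀ i < m, z i = e i := by
  by_contra! hc
  choose r hr z hw h1 h2 i him hi using fun k : ℕ => hc (1 / (k + 1)) Nat.one_div_pos_of_nat
  have t0 := tendsto_one_div_add_atTop_nhds_zero_nat (𝕜 := ℝ)
  have hrq : Tendsto r atTop (𝓝 q) := by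
    rw [tendsto_iff_dist_tendsto_zero]
    exact squeeze_zero (fun _ => dist_nonneg) (fun k => (hr k).le) t0
  have hv : Tendsto (fun k => value (r k) (z k)) atTop (𝓝 1) :=
    tendsto_of_tendsto_of_tendsto_of_le_of_le (by simpa using t0.const_sub 1) tendsto_const_nhds
      (fun k => (h2 k).le) h1
  obtain ⟨d, -, φ, hφ, hd⟩ := isCompact_univ.tendsto_subseq (x := z) (fun _ => Set.mem_univ _)
  have hr' := hrq.comp hφ.tendsto_atTop
  have hdw : Weak q d := weak_of_tendsto hq hr' hd (Eventually.of_forall fun k => hw _)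
  have hd1 : value q d = 1 :=
    tendsto_nhds_unique (tendsto_value hq hr' hd) (hv.comp hφ.tendsto_atTop)
  obtain rfl := hdw.ext hq hq2 hd1 he he1
  obtain ⟨k, hk⟩ := (eventually_agree hd m).exists
  exact hi (φ k) (hk _ (him _))

/-- A weak expansion of `1` of the form `c c̄ c c̄ …` is isolated among the weak sequences of nearby
bases. -/
lemma Weak.isolated {q : ℝ} (hq : 3 / 2 ≤ q) (hq2 : q < 2) {e : DigitSeq} (he : Weak q e)
    (he1 : value q e = 1) {m : ℕ} (hm : Univoque.reflect (Univoque.shift m e) = e) :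
    ∀ᶠ r in 𝓝 q, ∀ z, Weak r z → value r z ≤ 1 → (∀ i < m, z i = e i) → z = e := by
  have hq1 : 1 < q := by linarith
  have hm0 : m ≠ 0 := by
    rintro rfl
    simpa using congrFun hm 0
  -- Otherwise the reflected tail from position `m - 1` is 1 followed by `e`, of value 2/q > 1.
  have hlast : e (m - 1) = true := by
    by_contra hc
    rw [Bool.not_eq_true] at hc
    have h := he.value_reflect_shift_le hq hq2.le he1 (m - 1)
    rw [reflect_shift, value_shift_step hq1, Nat.sub_add_cancel (by omega), ← reflect_shift, hm,
      he1, reflect_apply, hc, Bool.not_false, digit_true, div_le_one (by linarith)] at h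
    linarith
  obtain ⟨ε, hε, hag⟩ := he.exists_agree hq1 hq2 he1 m
  -- The function is a lower bound for the value of the reflected `m`-tail of `z` in base `r`, as
  -- value r z ≤ 1.
  have hlim : Tendsto (fun r => value r e + r ^ m * (value r e - 1)) (𝓝 q) (𝓝 1) := by
    have t : Tendsto (fun r => value r e) (𝓝 q) (𝓝 1) :=
      he1 ▸ tendsto_value hq1 tendsto_id tendsto_const_nhds
    have t2 : Tendsto (fun r : ℝ => r ^ m) (𝓝 q) (𝓝 (q ^ m)) := (continuous_pow m).continuousAt
    simpa using t.add (t2.mul (t.sub_const 1))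
  filter_upwards [lt_mem_nhds hq1, hlim.eventually (lt_mem_nhds (show 1 - ε < 1 by linarith)),
    Metric.ball_mem_nhds q hε] with r hr hrε hrq
  have hstep : ∀ z, Weak r z → value r z ≤ 1 → (∀ i < m, z i = e i) →
      Weak r (Univoque.reflect (Univoque.shift m z)) ∧
      value r (Univoque.reflect (Univoque.shift m z)) ≤ 1 ∧
      ∀ i < m, Univoque.reflect (Univoque.shift m z) i = e i := by
    intro z hw h1 ha
    have hw' := (hw.shift m).reflect
    have h2 : value r (Univoque.reflect (Univoque.shift m z)) ≤ 1 := by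
      have := (hw (m - 1)).2 ((ha _ (by omega)).trans hlast)
      rwa [Nat.sub_add_cancel (by omega)] at this
    refine ⟨hw', h2, hag r hrq _ hw' h2 (hrε.trans_le ?_)⟩
    have h3 := value_sub_of_agree hr ha
    have h4 : value r e = 1 / (r - 1) - value r (Univoque.shift m e) := by
      conv_lhs => rw [← hm]
      exact value_reflect hr _
    rw [eq_div_iff (by positivity)] at h3
    rw [value_reflect hr]
    have h5 : 0 ≤ (1 - value r z) * r ^ m := mul_nonneg (by linarith) (by positivity)
    linarith
  -- The reflected `m`-tail of `z` satisfies the same assumptions as `z`, so the agreement with `e`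
  -- propagates block by block.
  have hall : ∀ i z, Weak r z → value r z ≤ 1 → (∀ i < m, z i = e i) → z i = e i := by
    intro i
    induction i using Nat.strong_induction_on with
    | _ i ih =>
      intro z hw h1 ha
      rcases lt_or_ge i m with h | h
      · exact ha i h
      · obtain ⟨a, b, c⟩ := hstep z hw h1 ha
        have h2 := ih (i - m) (by omega) _ a b c
        have h3 := congrFun hm (i - m)
        simp only [reflect_apply, shift_apply, Nat.sub_add_cancel h] at h2 h3
        rw [← h3] at h2
        simpa using h2
  exact fun z hw h1 ha => funext fun i => hall i z hw h1 ha

lemma eventually_eq_of_not_mem_closureU {q : ℝ} (hq : 3 / 2 ≤ q) (hq2 : q < 2) (hqU : q ∉ closureU)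
    {e : DigitSeq} (he : Weak q e) (he1 : value q e = 1) {r : ℕ → ℝ} {z : ℕ → DigitSeq}
    (hr : Tendsto r atTop (𝓝 q)) (hz : Tendsto z atTop (𝓝 e)) (hw : ∀ k, Weak (r k) (z k))
    (h1 : ∀ᶠ k in atTop, value (r k) (z k) ≤ 1) : ∀ᶠ k in atTop, z k = e := by
  have : ∃ m, Univoque.reflect (Univoque.shift m e) = e := by
    by_contra! hc
    exact hqU (mem_closureU_of_weak hq hq2 he he1 hc)
  obtain ⟨m, hm⟩ := this
  filter_upwards [hr.eventually (he.isolated hq hq2 he1 hm), eventually_agree hz m, h1]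
    with k a b c
  exact a _ (hw k) c b

/-! ### Attainment of the infimum outside the closure of 𝒰 -/

lemma isLeast_of_mem {x : ℝ} (h : smallestBase x ∈ univoqueBases x) :
    IsLeast (univoqueBases x) (smallestBase x) :=
  ⟨h, fun _ hr => csInf_le ⟨1, fun _ h => h.1.1.le⟩ hr⟩

/-- If the infimum of `𝒰(x)` is not attained, then the unique expansions of `x` in bases close to
it converge to an expansion that is weak but not strict. -/
lemma exists_limit_of_not_mem {x : ℝ} (hx : x ∈ Set.Ioo (0 : ℝ) 1)
    (h : smallestBase x ∉ univoqueBases x) :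
    3 / 2 ≤ smallestBase x ∧ smallestBase x < 2 ∧
      ∃ (r : ℕ → ℝ) (z : ℕ → DigitSeq) (d : DigitSeq) (n : ℕ),
      (∀ k, smallestBase x < r k) ∧ Tendsto r atTop (𝓝 (smallestBase x)) ∧
      (∀ k, value (r k) (z k) = x) ∧ (∀ k, Strict (r k) (z k)) ∧ Tendsto z atTop (𝓝 d) ∧
      value (smallestBase x) d = x ∧ Weak (smallestBase x) d ∧
      (d n = false ∧ value (smallestBase x) (shift (n + 1) d) = 1 ∨
        d n = true ∧ value (smallestBase x) (reflect (shift (n + 1) d)) = 1) := by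
  have hne := univoqueBases_nonempty hx
  have hbdd : BddBelow (univoqueBases x) := ⟨1, fun _ h => h.1.1.le⟩
  have hq : 3 / 2 ≤ smallestBase x := le_csInf hne fun _ hr => (base_ge hx.1 hx.2.le hr).le
  have hlt : ∀ r ∈ univoqueBases x, smallestBase x < r := fun r hr =>
    lt_of_le_of_ne (csInf_le hbdd hr) fun hc => h (hc ▸ hr)
  have hq2 : smallestBase x < 2 := by
    obtain ⟨r, hr⟩ := hne
    exact (hlt r hr).trans_le hr.1.2
  have hq1 : 1 < smallestBase x := by linarith
  refine ⟨hq, hq2, ?_⟩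
  obtain ⟨r, hrq, hr⟩ : ∃ r : ℕ → ℝ, Tendsto r atTop (𝓝 (smallestBase x)) ∧
      ∀ k, r k ∈ univoqueBases x := by
    obtain ⟨r, -, h1, h2⟩ := exists_seq_tendsto_sInf hne hbdd
    exact ⟨r, h1, h2⟩
  choose h1 h2 z hz hs using fun k => mem_univoqueBases_iff.1 (hr k)
  obtain ⟨d, φ, hφ, hd, hdx, hdw⟩ := exists_limit hq1 hrq z hz fun k => (hs k).weak
  have hns : ¬ Strict (smallestBase x) d := fun hc =>
    h (mem_univoqueBases_iff.2 ⟨hq1, hq2.le, d, hdx, hc⟩)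
  simp only [Strict, not_forall] at hns
  obtain ⟨n, hn⟩ := hns
  refine ⟨r ∘ φ, z ∘ φ, d, n, fun k => hlt _ (hr _), hrq.comp hφ.tendsto_atTop, fun k => hz _,
    fun k => hs _, hd, hdx, hdw, ?_⟩
  cases hdn : d n
  · simp only [hdn, true_imp_iff, Bool.false_eq_true, false_imp_iff, and_true, not_lt] at hn
    exact Or.inl ⟨rfl, le_antisymm ((hdw n).1 hdn) hn⟩
  · simp only [hdn, true_imp_iff, Bool.true_eq_false, false_imp_iff, true_and, not_lt] at hn
    exact Or.inr ⟨rfl, le_antisymm ((hdw n).2 hdn) hn⟩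

lemma isLeast_of_not_mem_closureU {x : ℝ} (hx : x ∈ Set.Ioo (0 : ℝ) 1)
    (h : smallestBase x ∉ closureU) : IsLeast (univoqueBases x) (smallestBase x) := by
  refine isLeast_of_mem ?_
  by_contra hc
  obtain ⟨hq, hq2, r, z, d, n, hlt, hr, hz, hs, hzd, hdx, hdw, hn⟩ := exists_limit_of_not_mem hx hc
  have hq1 : 1 < smallestBase x := by linarith
  have hag := eventually_agree hzd (n + 1)
  have htail := (continuous_shift (n + 1)).continuousAt.tendsto.comp hzd
  have hev : ∀ᶠ k in atTop, shift (n + 1) (z k) = shift (n + 1) d := by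
    rcases hn with ⟨h1, h2⟩ | ⟨h1, h2⟩
    · refine eventually_eq_of_not_mem_closureU hq hq2 h (hdw.shift _) h2 hr htail
        (fun k => (hs k).weak.shift _) ?_
      filter_upwards [hag] with k hk
      exact ((hs k n).1 ((hk n (by omega)).trans h1)).le
    · have := eventually_eq_of_not_mem_closureU hq hq2 h (hdw.shift _).reflect h2 hr
        (continuous_reflect.continuousAt.tendsto.comp htail)
        (fun k => ((hs k).weak.shift _).reflect) (by
          filter_upwards [hag] with k hk
          exact ((hs k n).2 ((hk n (by omega)).trans h1)).le)
      filter_upwards [this] with k hk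
      simpa using congrArg reflect hk
  obtain ⟨k, hk1, hk2⟩ := (hag.and hev).exists
  have hzk : z k = d := by
    rw [← splice_shift (n + 1) (z k), hk2]
    funext i
    by_cases hi : i < n + 1
    · rw [splice_lt _ _ hi, hk1 i hi]
    · exact (congrFun (splice_shift (n + 1) d) i) ▸ by simp [splice, hi]
  -- A sequence with a digit 1 has strictly smaller value in a larger base, so `d` cannot represent
  -- `x` in both bases.
  obtain ⟨i, hi⟩ : ∃ i, d i = true := by
    by_contra! h0
    have : d = fun _ => false := funext fun i => by simpa using h0 i
    rw [this, value_zeros] at hdx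
    linarith [hx.1]
  have := value_strictAnti hq1 (hlt k) hi
  rw [hdx, ← hzk, hz k] at this
  exact lt_irrefl _ this

/-! ### The exceptional null set -/

/-- The sequences that are eventually constant. -/
def eventuallyConst : Set DigitSeq := {d | ∃ N, ∀ i ≥ N, d i = d N}

lemma countable_eventuallyConst : eventuallyConst.Countable := by
  classical
  refine (Set.countable_range
    fun p : Finset ℕ × Bool => (fun i => if i ∈ p.1 then !p.2 else p.2 : DigitSeq)).mono ?_
  rintro d ⟨N, hN⟩
  refine ⟨((Finset.range N).filter fun i => d i ≠ d N, d N), ?_⟩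
  funext i
  by_cases hi : d i = d N
  · simp [hi]
  · have : i < N := by
      by_contra! hc
      exact hi (hN i hc)
    simp only [Finset.mem_filter, Finset.mem_range, this, hi, ne_eq, not_false_eq_true, and_self,
      if_true]
    cases h1 : d i <;> cases h2 : d N <;> simp_all

/-- For such `d` the value is a rational function of the base with poles only at 0 and 1. -/
lemma differentiableOn_value {N : ℕ} {d : DigitSeq} (hd : ∀ i ≥ N, d i = d N) :
    DifferentiableOn ℝ (fun q => value q d) (Set.Ioi 1) := by
  induction N generalizing d with
  | zero =>
    have h : ∀ q ∈ Set.Ioi (1 : ℝ), value q d = digit (d 0) / (q - 1) := by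
      intro q hq
      have hc : d = fun _ => d 0 := funext fun i => hd i (Nat.zero_le i)
      cases h0 : d 0
      · rw [hc, h0, value_zeros]; simp
      · rw [hc, h0, value_ones hq]; simp
    refine DifferentiableOn.congr ?_ h
    refine DifferentiableOn.div (by fun_prop) (by fun_prop) fun q hq => ?_
    exact (sub_pos.2 hq).ne'
  | succ N ih =>
    have h1 := ih (d := shift 1 d) fun i hi => hd (i + 1) (by omega)
    refine DifferentiableOn.congr (f := fun q => (digit (d 0) + value q (shift 1 d)) / q) ?_
      fun q hq => value_step hq d
    exact ((differentiableOn_const _).add h1).div differentiableOn_id fun q hq =>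
      (zero_lt_one.trans hq).ne'

/-- The numbers with an eventually constant expansion in some base in the closure of `𝒰`. -/
def exceptional : Set ℝ := ⋃ d ∈ eventuallyConst, (fun q => value q d) '' closureU

lemma volume_exceptional : volume exceptional = 0 := by
  refine (measure_biUnion_null_iff countable_eventuallyConst).2 fun d ⟨N, hN⟩ => ?_
  refine addHaar_image_eq_zero_of_differentiableOn_of_addHaar_eq_zero volume
    ((differentiableOn_value hN).mono fun q hq => ?_) volume_closureU
  have := (closureU_subset hq).1
  exact Set.mem_Ioi.2 (by linarith)

lemma wordZeroOnes_mem (w : List Bool) : wordZeroOnes w ∈ eventuallyConst := by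
  refine ⟨w.length + 1, fun i hi => ?_⟩
  simp [wordZeroOnes, appendSeq, show ¬ i < w.length + 1 by omega]

lemma value_zero_word {q : ℝ} (hq : 1 < q) (j : ℕ) :
    value q (wordZeroOnes (List.replicate j false)) = 1 / (q ^ (j + 1) * (q - 1)) := by
  have h1 : ∀ i < j + 1, wordZeroOnes (List.replicate j false) i = false := by
    intro i hi
    simp only [wordZeroOnes, appendSeq, List.length_append, List.length_replicate,
      List.length_singleton, hi, if_true]
    rw [show [false] = List.replicate 1 false from rfl, List.replicate_append_replicate]
    simp
  have h2 : shift (j + 1) (wordZeroOnes (List.replicate j false)) = fun _ => true := by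
    funext i
    simp [wordZeroOnes, appendSeq, show j < i + (j + 1) by omega]
  rw [value_prefix hq _ (j + 1), h2, value_ones hq,
    Finset.sum_eq_zero fun i hi => by rw [h1 i (Finset.mem_range.1 hi)]; simp]
  rw [zero_add, div_div, mul_comm]

/-- Every base reached with word `w` satisfies (w01^∞)_q = x: the initial root equation says so for
w = 0^j, and the later bases are defined by it. -/
lemma typeI_subset : typeI ⊆ exceptional := by
  rintro x ⟨hx, w, q, hr, hq⟩
  refine Set.mem_biUnion (wordZeroOnes_mem w) ⟨q, hq, ?_⟩
  cases hr with
  | start j _ _ _ hq1 hroot =>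
    simp only
    rw [value_zero_word hq1.1, hroot, one_div_one_div]
  | next w q q' a n _ _ _ _ _ hv => exact hv

lemma exists_eventuallyConst {q : ℝ} (hq : 1 < q) {d : DigitSeq} {n : ℕ}
    (h : d n = false ∧ value q (shift (n + 1) d) = 1 ∨
        d n = true ∧ value q (reflect (shift (n + 1) d)) = 1) :
    ∃ e ∈ eventuallyConst, value q e = value q d := by
  -- A digit 0 with its tail is replaced by 1 0^∞, a digit 1 with its tail by 0 1^∞.
  obtain ⟨b, hb⟩ : ∃ b : Bool, digit (!b) + value q (fun _ => b) =
      digit (d n) + value q (shift (n + 1) d) := by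
    rcases h with ⟨h1, h2⟩ | ⟨h1, h2⟩
    · exact ⟨false, by rw [h1, h2, value_zeros]; simp⟩
    · rw [value_reflect hq] at h2
      exact ⟨true, by rw [h1, value_ones hq]; simp only [Bool.not_true, digit_false, digit_true]; linarith⟩
  refine ⟨splice n d (splice 1 (fun _ => !b) fun _ => b), ⟨n + 1, fun i hi => ?_⟩, ?_⟩
  · simp [splice, show ¬ i < n by omega, show i - n ≠ 0 by omega]
  · have h1 := value_sub_of_agree hq (d := splice n d (splice 1 (fun _ => !b) fun _ => b)) (e := d)
      (n := n) (fun i hi => splice_lt _ _ hi)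
    rw [shift_splice, value_step hq (splice 1 _ _), shift_splice, splice_lt _ _ one_pos,
      value_shift_step hq d, hb, sub_self, zero_div] at h1
    linarith

lemma mem_exceptional {x : ℝ} (hx : x ∈ Set.Ioo (0 : ℝ) 1)
    (h : ¬ IsLeast (univoqueBases x) (smallestBase x)) : x ∈ exceptional := by
  have hU : smallestBase x ∈ closureU := by
    by_contra hc
    exact h (isLeast_of_not_mem_closureU hx hc)
  obtain ⟨hq, -, -, -, d, n, -, -, -, -, -, hdx, -, hn⟩ :=
    exists_limit_of_not_mem hx fun hc => h (isLeast_of_mem hc)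
  obtain ⟨e, he, hv⟩ := exists_eventuallyConst (by linarith) hn
  exact Set.mem_biUnion he ⟨_, hU, hv.trans hdx⟩

end Univoque

theorem proposition4p1 :
    (∀ x ∈ Set.Ioo (0 : ℝ) 1, Univoque.smallestBase x ∉ Univoque.closureU →
      IsLeast (Univoque.univoqueBases x) (Univoque.smallestBase x)) ∧
    MeasureTheory.volume Univoque.typeI = 0 ∧
    (∀ᵐ x ∂(MeasureTheory.volume.restrict (Set.Ioo (0 : ℝ) 1)),
      IsLeast (Univoque.univoqueBases x) (Univoque.smallestBase x)) := by
  refine ⟨fun x hx h => Univoque.isLeast_of_not_mem_closureU hx h,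
    MeasureTheory.measure_mono_null Univoque.typeI_subset Univoque.volume_exceptional, ?_⟩
  rw [MeasureTheory.ae_restrict_iff' measurableSet_Ioo]
  have h := MeasureTheory.measure_eq_zero_iff_ae_notMem.1 Univoque.volume_exceptional
  filter_upwards [h] with x hx hx01
  by_contra hc
  exact hx (Univoque.mem_exceptional hx01 hc)
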